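/- Let $R$ be a Dedekind domain. A \emph{lattice} of rank $n$ over $R$ is a finitely generated torsion-free $R$-module of rank $n$, and a \emph{quintic ring} over $R$ is a commutative $R$-algebra that is, as an $R$-module, a lattice of rank $5$. For a lattice $M$ of rank $5$, let $\mu\mapsto\mu^{\square}$ be the (well-defined) quadratic map $\Lambda^2M\to\Lambda^4M$ given by \[ \Bigl(\sum_{i=1}^n v_i\wedge w_i\Bigr)^{\square}=\sum_{1\le i<j\le n} v_i\wedge w_i\wedge v_j\wedge w_j , \] and for $\mu\in\Lambda^2M$ and $\alpha,\beta\in\Lambda^4M$ let $\mu(\alpha,\beta)\in(\Lambda^5M)^{\otimes2}$ be the contraction that is linear in $\mu$ and satisfies \[ (v\wedge w)(\alpha,\beta)=(\alpha\wedge v)\otimes(\beta\wedge w)-(\alpha\wedge w)\otimes(\beta\wedge v)\qquad(v,w\in M). \] Let $Q$ be a quintic ring over $R$ and let $L\cong Q/R$. A \emph{resolvent} of $Q$ is a triple $(M,\phi,\theta)$ consisting of a lattice $M$ of rank $5$ and $R$-linear maps \[ \phi:\Lambda^4L\otimes L\to\Lambda^2M,\qquad \theta:\Lambda^5M\to(\Lambda^4L)^{\otimes3}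 \] such that, for all $\lambda_1,\lambda_2,\lambda_3\in\Lambda^4L$ and $x,y,z\in L$, \[ \theta^{\otimes2}\bigl[\phi(\lambda_1\otimes x)\bigl(\phi(\lambda_2\otimes y)^{\square},\phi(\lambda_3\otimes z)^{\square}\bigr)\bigr] =\lambda_1\lambda_2^2\lambda_3^2\,(x\wedge y\wedge z\wedge yz)\quad\text{in }(\Lambda^4L)^{\otimes6}, \] where $yz$ denotes the image in $L$ of the product of any lifts of $y$ and $z$ to $Q$ (the wedge product $x\wedge y\wedge z\wedge yz$ does not depend on the lifts). \textbf{Theorem 1.} Let $L$ and $M$ be lattices over $R$ of ranks $4$ and $5$, and let $\phi:\Lambda^4L\otimes L\to\Lambda^2M$ and $\theta:\Lambda^5M\to(\Lambda^4L)^{\otimes3}$ be arbitrary $R$-linear maps. Then there is a quintic ring $Q$ over $R$ with an isomorphism $Q/R\cong L$ such that $(M,\phi,\theta)$ is a resolvent of $Q$. It is unique up to isomorphism: if $Q_1$ and $Q_2$, with isomorphisms $Q_1/R\cong L$ and $Q_2/R\cong L$, are two such rings, then there is an isomorphism of $R$-algebras $Q_1\to Q_2$ that is compatible with the quotient maps $Q_1\to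 L$ and $Q_2\to L$. -/

import Mathlib

open scoped TensorProduct

universe u v w s t

noncomputable section

namespace QuinticResolvent

/-- A lattice of rank `n` over a domain `R`: a finitely generated torsion-free `R`-module whose
rank is `n`. -/
structure IsLatticeOfRank (R : Type u) [CommRing R] (N : Type v) [AddCommGroup N] [Module R N]
    (n : ℕ) : Prop where
  finite : Module.Finite R N
  torsionFree : Module.IsTorsionFree R N
  finrank_eq : Module.finrank R N = n

/-- The quotient module `Q / R` of an `R`-algebra `Q` by the image of `R`. -/
abbrev ModBase (R : Type u) (Q : Type v) [CommRing R] [CommRing Q] [Algebra R Q] : Type v :=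
  Q ⧸ LinearMap.range (Algebra.linearMap R Q)

section Wedge

variable {R : Type u} [CommRing R] {M : Type v} [AddCommGroup M] [Module R M]

/-- The wedge product `Λᵐ M × Λⁿ M → Λᵐ⁺ⁿ M`. -/
def wedge (m n : ℕ) : ⋀[R]^m M →ₗ[R] ⋀[R]^n M →ₗ[R] ⋀[R]^(m + n) M :=
  LinearMap.mk₂ R
    (fun a b => ⟨(a : ExteriorAlgebra R M) * b, SetLike.mul_mem_graded a.2 b.2⟩)
    (fun _ _ _ => Subtype.ext (add_mul _ _ _))
    (fun _ _ _ => Subtype.ext (smul_mul_assoc _ _ _))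
    (fun _ _ _ => Subtype.ext (mul_add _ _ _))
    (fun _ _ _ => Subtype.ext (mul_smul_comm _ _ _))

@[simp]
theorem coe_wedge (m n : ℕ) (a : ⋀[R]^m M) (b : ⋀[R]^n M) :
    ((wedge m n a b : ⋀[R]^(m + n) M) : ExteriorAlgebra R M) = a * b := rfl

/-- `v ∧ w` in `Λ² M`. -/
abbrev wedge₂ (v w : M) : ⋀[R]^2 M := exteriorPower.ιMulti R 2 ![v, w]

/-- `v ∧ w ∧ v' ∧ w'` in `Λ⁴ M`. -/
abbrev wedge₄ (v w v' w' : M) : ⋀[R]^4 M := exteriorPower.ιMulti R 4 ![v, w, v', w']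

theorem coe_wedge₂ (v w : M) :
    (wedge₂ (R := R) v w : ExteriorAlgebra R M) = ExteriorAlgebra.ι R v * ExteriorAlgebra.ι R w := by
  simp [wedge₂, ExteriorAlgebra.ιMulti_apply]

theorem wedge₂_add_left (v v' w : M) :
    wedge₂ (R := R) (v + v') w = wedge₂ v w + wedge₂ v' w := by
  apply Subtype.ext
  rw [Submodule.coe_add]
  simp only [coe_wedge₂, map_add, add_mul]

theorem wedge₂_add_right (v w w' : M) :
    wedge₂ (R := R) v (w + w') = wedge₂ v w + wedge₂ v w' := by
  apply Subtype.ext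
  rw [Submodule.coe_add]
  simp only [coe_wedge₂, map_add, mul_add]

theorem wedge₂_smul_left (r : R) (v w : M) : wedge₂ (R := R) (r • v) w = r • wedge₂ v w := by
  apply Subtype.ext
  rw [Submodule.coe_smul]
  simp only [coe_wedge₂, map_smul, smul_mul_assoc]

theorem wedge₂_smul_right (r : R) (v w : M) : wedge₂ (R := R) v (r • w) = r • wedge₂ v w := by
  apply Subtype.ext
  rw [Submodule.coe_smul]
  simp only [coe_wedge₂, map_smul, mul_smul_comm]

theorem wedge_wedge₂ (a b c d : M) :
    wedge 2 2 (wedge₂ (R := R) a b) (wedge₂ c d) = wedge₄ a b c d := by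
  apply Subtype.ext
  rw [coe_wedge, coe_wedge₂, coe_wedge₂]
  simp [wedge₄, ExteriorAlgebra.ιMulti_apply, mul_assoc]

/-! ### The quadratic map `μ ↦ μ^□` -/

/-- Every element of `Λ² M` is a finite sum of elements `v ∧ w`. -/
theorem exists_sum_wedge₂ (μ : ⋀[R]^2 M) :
    ∃ (n : ℕ) (p : Fin n → M × M), μ = ∑ i, wedge₂ (p i).1 (p i).2 := by
  have h : μ ∈ Submodule.span R (Set.range (exteriorPower.ιMulti R 2 (M := M))) := by
    rw [exteriorPower.ιMulti_span]; trivial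
  induction h using Submodule.span_induction with
  | mem x hx =>
    obtain ⟨a, rfl⟩ := hx
    refine ⟨1, fun _ => (a 0, a 1), ?_⟩
    simp only [Fin.sum_univ_one, wedge₂]
    congr 1
    ext i
    fin_cases i <;> rfl
  | zero => exact ⟨0, Fin.elim0, by simp⟩
  | add x y _ _ hx hy =>
    obtain ⟨n, p, rfl⟩ := hx
    obtain ⟨m, q, rfl⟩ := hy
    refine ⟨n + m, Fin.append p q, ?_⟩
    simp [Fin.sum_univ_add]
  | smul r x _ hx =>
    obtain ⟨n, p, rfl⟩ := hx
    refine ⟨n, fun i => (r • (p i).1, (p i).2), ?_⟩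
    rw [Finset.smul_sum]
    refine Finset.sum_congr rfl fun i _ => ?_
    exact (wedge₂_smul_left r _ _).symm

/-- The sum `∑_{i < j} vᵢ ∧ wᵢ ∧ vⱼ ∧ wⱼ` attached to a finite family of pairs `(vᵢ, wᵢ)`. -/
def boxSum {n : ℕ} (p : Fin n → M × M) : ⋀[R]^4 M :=
  ∑ i, ∑ j ∈ Finset.Ioi i, wedge₄ (p i).1 (p i).2 (p j).1 (p j).2

/-- The quadratic map `μ ↦ μ^□` from `Λ² M` to `Λ⁴ M`: write `μ` as `∑ vᵢ ∧ wᵢ` and take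
`∑_{i < j} vᵢ ∧ wᵢ ∧ vⱼ ∧ wⱼ`. The result does not depend on the presentation of `μ`, by
`box_sum` below. -/
def box (μ : ⋀[R]^2 M) : ⋀[R]^4 M :=
  boxSum (Classical.choose (Classical.choose_spec (exists_sum_wedge₂ μ)))

theorem wedge₂_self (v : M) : wedge₂ (R := R) v v = 0 :=
  (exteriorPower.ιMulti R 2 (M := M)).map_eq_zero_of_eq ![v, v] (i := 0) (j := 1) rfl (by decide)

theorem wedge_comm₂ (a b : ⋀[R]^2 M) : wedge 2 2 a b = wedge 2 2 b a := by
  obtain ⟨n, p, rfl⟩ := exists_sum_wedge₂ a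
  obtain ⟨m, q, rfl⟩ := exists_sum_wedge₂ b
  simp only [map_sum, LinearMap.sum_apply, wedge_wedge₂]
  rw [Finset.sum_comm]
  refine Finset.sum_congr rfl fun i _ => Finset.sum_congr rfl fun j _ => ?_
  let σ : Equiv.Perm (Fin 4) := Equiv.swap 0 2 * Equiv.swap 1 3
  have h := (exteriorPower.ιMulti R 4 (M := M)).map_perm
    ![(q j).1, (q j).2, (p i).1, (p i).2] σ
  have hσ : Equiv.Perm.sign σ = 1 := by decide
  rw [hσ, one_smul] at h
  unfold wedge₄
  rw [← h]
  congr 1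
  ext k
  fin_cases k <;> rfl

theorem wedge₄_left (a b c : M) : wedge₄ (R := R) a c b c = 0 :=
  (exteriorPower.ιMulti R 4 (M := M)).map_eq_zero_of_eq ![a, c, b, c] (i := 1) (j := 3) rfl
    (by decide)

theorem wedge₄_right (a b c : M) : wedge₄ (R := R) c a c b = 0 :=
  (exteriorPower.ιMulti R 4 (M := M)).map_eq_zero_of_eq ![c, a, c, b] (i := 0) (j := 2) rfl
    (by decide)

variable (R M) in
/-- Auxiliary group for `box_sum`: pairs `(a, b)` in `Λ² M × Λ⁴ M` with addition
`(a, b) + (a', b') = (a + a', b + b' + a ∧ a')`. -/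
@[ext]
structure BoxGroup where
  /-- the component in degree two -/
  fst : ⋀[R]^2 M
  /-- the component in degree four -/
  snd : ⋀[R]^4 M

instance : Add (BoxGroup R M) :=
  ⟨fun x y => ⟨x.fst + y.fst, x.snd + y.snd + wedge 2 2 x.fst y.fst⟩⟩

instance : Zero (BoxGroup R M) := ⟨⟨0, 0⟩⟩

theorem BoxGroup.fst_add (x y : BoxGroup R M) : (x + y).fst = x.fst + y.fst := rfl

theorem BoxGroup.snd_add (x y : BoxGroup R M) :
    (x + y).snd = x.snd + y.snd + wedge 2 2 x.fst y.fst := rfl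

theorem BoxGroup.fst_zero : (0 : BoxGroup R M).fst = 0 := rfl

theorem BoxGroup.snd_zero : (0 : BoxGroup R M).snd = 0 := rfl

instance : AddCommMonoid (BoxGroup R M) where
  add_assoc x y z := by
    ext1
    · simp only [BoxGroup.fst_add, add_assoc]
    · simp only [BoxGroup.fst_add, BoxGroup.snd_add, map_add, LinearMap.add_apply]
      abel
  zero_add x := by
    ext1
    · simp only [BoxGroup.fst_add, BoxGroup.fst_zero, zero_add]
    · simp only [BoxGroup.snd_add, BoxGroup.snd_zero, BoxGroup.fst_zero, zero_add, map_zero,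
        LinearMap.zero_apply, add_zero]
  add_zero x := by
    ext1
    · simp only [BoxGroup.fst_add, BoxGroup.fst_zero, add_zero]
    · simp only [BoxGroup.snd_add, BoxGroup.snd_zero, BoxGroup.fst_zero, map_zero, add_zero]
  add_comm x y := by
    ext1
    · simp only [BoxGroup.fst_add, add_comm]
    · simp only [BoxGroup.snd_add, wedge_comm₂ x.fst, add_comm x.snd]
  nsmul := nsmulRec

/-- Auxiliary additive map `w ↦ (v ∧ w, 0)`. -/
def boxHomAux (v : M) : M →+ BoxGroup R M where
  toFun w := ⟨wedge₂ v w, 0⟩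
  map_zero' := by
    ext1
    · change wedge₂ (R := R) v 0 = 0
      simpa only [zero_smul] using wedge₂_smul_right (0 : R) v 0
    · rfl
  map_add' w w' := by
    ext1
    · exact wedge₂_add_right v w w'
    · simp only [BoxGroup.snd_add, wedge_wedge₂, wedge₄_right, add_zero]

variable (R M) in
/-- Auxiliary additive map `M ⊗ M → BoxGroup`, `v ⊗ w ↦ (v ∧ w, 0)`. -/
def boxHom : M ⊗[R] M →+ BoxGroup R M :=
  TensorProduct.liftAddHom
    { toFun := boxHomAux
      map_zero' := by
        ext w : 2
        · change wedge₂ (R := R) 0 w = 0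
          simpa only [zero_smul] using wedge₂_smul_left (0 : R) 0 w
        · rfl
      map_add' := fun v v' => by
        ext w : 2
        · exact wedge₂_add_left v v' w
        · change (0 : ⋀[R]^4 M) = 0 + 0 + wedge 2 2 (wedge₂ v w) (wedge₂ v' w)
          rw [wedge_wedge₂, wedge₄_left, add_zero, add_zero] }
    fun r v w => by
      ext1
      · exact (wedge₂_smul_left r v w).trans (wedge₂_smul_right r v w).symm
      · rfl

theorem boxHom_tmul (v w : M) : boxHom R M (v ⊗ₜ w) = ⟨wedge₂ v w, 0⟩ := rfl

theorem boxHom_smul (r : R) (t : M ⊗[R] M) :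
    boxHom R M (r • t) = ⟨r • (boxHom R M t).fst, r ^ 2 • (boxHom R M t).snd⟩ := by
  induction t using TensorProduct.induction_on with
  | zero => rw [smul_zero, map_zero]; ext1 <;> simp [BoxGroup.fst_zero, BoxGroup.snd_zero]
  | tmul v w =>
    rw [TensorProduct.smul_tmul', boxHom_tmul, boxHom_tmul, wedge₂_smul_left, smul_zero]
  | add x y hx hy =>
    rw [smul_add, map_add, map_add, hx, hy]
    ext1
    · simp only [BoxGroup.fst_add, smul_add]
    · simp only [BoxGroup.snd_add, smul_add, map_smul, LinearMap.smul_apply, smul_smul, pow_two]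

/-- `v ∧ w ↦ v ⊗ w` is well defined modulo the elements `v ⊗ v`. -/
theorem mem_span_of_boxHom_fst (t : M ⊗[R] M) (ht : (boxHom R M t).fst = 0) :
    t ∈ Submodule.span R (Set.range fun v : M => v ⊗ₜ[R] v) := by
  set S := Submodule.span R (Set.range fun v : M => v ⊗ₜ[R] v) with hS
  let f : M [⋀^Fin 2]→ₗ[R] ((M ⊗[R] M) ⧸ S) :=
    { MultilinearMap.mk' (fun m : Fin 2 → M => S.mkQ (m 0 ⊗ₜ[R] m 1))
        (fun m i x y => by
          fin_cases i <;> simp [TensorProduct.add_tmul, TensorProduct.tmul_add])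
        (fun m i c x => by
          fin_cases i <;> simp [← TensorProduct.smul_tmul']) with
      map_eq_zero_of_eq' := fun m i j hm hij => by
        have h01 : m 0 = m 1 := by
          fin_cases i <;> fin_cases j <;> simp_all
        change S.mkQ (m 0 ⊗ₜ[R] m 1) = 0
        rw [h01, Submodule.mkQ_apply, Submodule.Quotient.mk_eq_zero]
        exact Submodule.subset_span ⟨m 1, rfl⟩ }
  have key : ∀ t, exteriorPower.alternatingMapLinearEquiv f (boxHom R M t).fst = S.mkQ t := by
    intro t
    induction t using TensorProduct.induction_on with
    | zero => simp [BoxGroup.fst_zero]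
    | tmul v w =>
      rw [boxHom_tmul]
      exact exteriorPower.alternatingMapLinearEquiv_apply_ιMulti f ![v, w]
    | add x y hx hy => rw [map_add, BoxGroup.fst_add, map_add, map_add, hx, hy]
  have := key t
  rw [ht, map_zero, Submodule.mkQ_apply, eq_comm, Submodule.Quotient.mk_eq_zero] at this
  exact this

theorem boxHom_eq_zero_of_fst (t : M ⊗[R] M) (ht : (boxHom R M t).fst = 0) :
    boxHom R M t = 0 := by
  have h := mem_span_of_boxHom_fst t ht
  clear ht
  induction h using Submodule.span_induction with
  | mem x hx =>
    obtain ⟨v, rfl⟩ := hx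
    simp only [boxHom_tmul, wedge₂_self]
    rfl
  | zero => exact map_zero _
  | add x y _ _ hx hy => rw [map_add, hx, hy, add_zero]
  | smul r x _ hx =>
    rw [boxHom_smul, hx]
    ext1 <;> simp [BoxGroup.fst_zero, BoxGroup.snd_zero]

theorem boxHom_eq_of_fst (s t : M ⊗[R] M) (h : (boxHom R M s).fst = (boxHom R M t).fst) :
    boxHom R M s = boxHom R M t := by
  let F : M ⊗[R] M →+ ⋀[R]^2 M := ⟨⟨fun t => (boxHom R M t).fst, by
    rw [map_zero]; rfl⟩, fun x y => by simp only [map_add, BoxGroup.fst_add]⟩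
  have h0 : (boxHom R M (s - t)).fst = 0 := by
    change F (s - t) = 0
    rw [map_sub, sub_eq_zero]
    exact h
  have := boxHom_eq_zero_of_fst _ h0
  rw [← sub_add_cancel s t, map_add, this, zero_add]

theorem boxHom_sum {n : ℕ} (p : Fin n → M × M) :
    boxHom R M (∑ i, (p i).1 ⊗ₜ[R] (p i).2) =
      ⟨∑ i, wedge₂ (p i).1 (p i).2, boxSum p⟩ := by
  induction n with
  | zero => simp only [Fin.sum_univ_zero, map_zero, boxSum]; rfl
  | succ n ih =>
    rw [Fin.sum_univ_succ, map_add, ih fun i => p i.succ, boxHom_tmul]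
    ext1
    · simp only [BoxGroup.fst_add, Fin.sum_univ_succ]
    · simp only [BoxGroup.snd_add, boxSum, Fin.sum_univ_succ, Fin.sum_Ioi_zero, Fin.sum_Ioi_succ,
        map_sum, wedge_wedge₂, zero_add]
      exact add_comm _ _

/-- The value `(∑ vᵢ ∧ wᵢ)^□ = ∑_{i < j} vᵢ ∧ wᵢ ∧ vⱼ ∧ wⱼ`, for every presentation. -/
theorem box_sum {n : ℕ} (p : Fin n → M × M) :
    box (∑ i, wedge₂ (R := R) (p i).1 (p i).2) = boxSum p := by
  set μ := ∑ i, wedge₂ (R := R) (p i).1 (p i).2 with hμ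
  have hq := Classical.choose_spec (Classical.choose_spec (exists_sum_wedge₂ μ))
  set q := Classical.choose (Classical.choose_spec (exists_sum_wedge₂ μ)) with hqdef
  have h := boxHom_eq_of_fst (R := R) (∑ i, (q i).1 ⊗ₜ[R] (q i).2) (∑ i, (p i).1 ⊗ₜ[R] (p i).2)
    (by rw [boxHom_sum, boxHom_sum]; exact hq.symm)
  rw [boxHom_sum, boxHom_sum] at h
  exact congrArg BoxGroup.snd h

/-! ### The contraction `μ(α, β)` -/

/-- The linear map `v ↦ α ∧ v` from `M` to `Λ⁵ M` attached to `α ∈ Λ⁴ M`. -/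
def wedgeVec (α : ⋀[R]^4 M) : M →ₗ[R] ⋀[R]^5 M where
  toFun v := ⟨(α : ExteriorAlgebra R M) * ExteriorAlgebra.ι R v,
    SetLike.mul_mem_graded (i := 4) (j := 1) (A := fun n : ℕ => ⋀[R]^n M) α.2
      (by
        change _ ∈ LinearMap.range (ExteriorAlgebra.ι R) ^ 1
        rw [pow_one]
        exact LinearMap.mem_range_self _ v)⟩
  map_add' v w := Subtype.ext (by simp [mul_add])
  map_smul' r v := Subtype.ext (by simp)

/-- For linear maps `f, g : M → N`, the alternating map
`(v, w) ↦ f v ⊗ g w - f w ⊗ g v`, that is, the value of `f ∧ g` on `v ∧ w`. -/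
def altPair {N : Type*} [AddCommGroup N] [Module R N] (f g : M →ₗ[R] N) :
    M [⋀^Fin 2]→ₗ[R] (N ⊗[R] N) :=
  { MultilinearMap.mk' (fun m : Fin 2 → M => f (m 0) ⊗ₜ[R] g (m 1) - f (m 1) ⊗ₜ[R] g (m 0))
      (fun m i x y => by
        fin_cases i <;> simp [TensorProduct.add_tmul, TensorProduct.tmul_add] <;> abel)
      (fun m i c x => by
        fin_cases i <;> simp [← TensorProduct.smul_tmul', smul_sub]) with
    map_eq_zero_of_eq' := fun m i j hm hij => by
      have h01 : m 0 = m 1 := by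
        fin_cases i <;> fin_cases j <;> simp_all
      change f (m 0) ⊗ₜ[R] g (m 1) - f (m 1) ⊗ₜ[R] g (m 0) = 0
      rw [h01, sub_self] }

/-- The contraction `μ(α, β) ∈ (Λ⁵ M)^{⊗ 2}` of `μ ∈ Λ² M` with `α, β ∈ Λ⁴ M`, which are viewed as
the maps `α ∧ ·` and `β ∧ ·` from `M` to `Λ⁵ M`: it is linear in `μ`, and
`(v ∧ w)(α, β) = (α ∧ v) ⊗ (β ∧ w) - (α ∧ w) ⊗ (β ∧ v)`. -/
def contract (μ : ⋀[R]^2 M) (α β : ⋀[R]^4 M) : ⋀[R]^5 M ⊗[R] ⋀[R]^5 M :=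
  exteriorPower.alternatingMapLinearEquiv (altPair (wedgeVec α) (wedgeVec β)) μ

theorem contract_wedge₂ (v w : M) (α β : ⋀[R]^4 M) :
    contract (wedge₂ v w) α β =
      wedgeVec α v ⊗ₜ[R] wedgeVec β w - wedgeVec α w ⊗ₜ[R] wedgeVec β v :=
  exteriorPower.alternatingMapLinearEquiv_apply_ιMulti (altPair (wedgeVec α) (wedgeVec β)) ![v, w]

end Wedge

section Resolvent

variable {R : Type u} [CommRing R] {L : Type v} [AddCommGroup L] [Module R L]
  {M : Type w} [AddCommGroup M] [Module R M]

/-- The map `θ ⊗ θ : (Λ⁵ M)^{⊗ 2} → (Λ⁴ L)^{⊗ 6}` obtained from `θ : Λ⁵ M → (Λ⁴ L)^{⊗ 3}`. -/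
def thetaSq (θ : ⋀[R]^5 M →ₗ[R] ⨂[R]^3 (⋀[R]^4 L)) :
    ⋀[R]^5 M ⊗[R] ⋀[R]^5 M →ₗ[R] ⨂[R]^6 (⋀[R]^4 L) :=
  (TensorPower.mulEquiv (R := R) (M := ⋀[R]^4 L) (n := 3) (m := 3)).toLinearMap ∘ₗ
    TensorProduct.map θ θ

/-- A quintic ring over `R`: a commutative `R`-algebra that is a lattice of rank `5`. -/
def IsQuinticRing (R : Type u) [CommRing R] (Q : Type v) [CommRing Q] [Algebra R Q] : Prop :=
  IsLatticeOfRank R Q 5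

/-- `(M, φ, θ)` is a resolvent of the ring `Q`, where `Q / R` is identified with `L` through `e`:
`M` is a lattice of rank `5`, and
`θ^{⊗ 2}[φ(λ₁ x)(φ(λ₂ y)^□, φ(λ₃ z)^□)] = λ₁ λ₂² λ₃² (x ∧ y ∧ z ∧ y z)` in `(Λ⁴ L)^{⊗ 6}`
for all `λ₁, λ₂, λ₃ ∈ Λ⁴ L` and `x, y, z ∈ L`; the product `y z` is formed in `Q` for any lifts
`y', z' ∈ Q` of `y, z`. -/
structure IsResolvent {Q : Type*} [CommRing Q] [Algebra R Q] (e : ModBase R Q ≃ₗ[R] L)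
    (φ : ⋀[R]^4 L ⊗[R] L →ₗ[R] ⋀[R]^2 M) (θ : ⋀[R]^5 M →ₗ[R] ⨂[R]^3 (⋀[R]^4 L)) : Prop where
  lattice : IsLatticeOfRank R M 5
  identity : ∀ (l₁ l₂ l₃ : ⋀[R]^4 L) (x y z : L) (y' z' : Q),
    e (Submodule.Quotient.mk y') = y → e (Submodule.Quotient.mk z') = z →
    thetaSq θ (contract (φ (l₁ ⊗ₜ x)) (box (φ (l₂ ⊗ₜ y))) (box (φ (l₃ ⊗ₜ z)))) =
      PiTensorProduct.tprod R ![l₁, l₂, l₂, l₃, l₃,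
        exteriorPower.ιMulti R 4 ![x, y, z, e (Submodule.Quotient.mk (y' * z'))]]

end Resolvent

end QuinticResolvent

end

noncomputable section

namespace QuinticResolvent

/-! ### A Jacobian criterion -/

section Jacobian

open MvPolynomial

variable {k B σ : Type*} [CommRing k] [CommRing B] [Algebra k B]

/-! Since `L` is projective, `Q` splits as `R × L`, and its product is a symmetric bilinear `β : L →
L → L` together with a symmetric form `B` with values in `R`. Another choice of lifts adds `t y • z
+ t z • y` to `β`, which does not affect `x ∧ y ∧ z ∧ β y z`. Conversely, polarizing this form
recovers all structure constants of `β` up to such a change (`exists_eq_mulOfConst_add`). Moreover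
`β` determines `B`, because associativity says `β (β x y) z - β x (β y z) = B y z • x - B x y • z`
and `L` has rank at least two. This gives uniqueness.

For existence in coordinates, `φ` is a quadruple `A` of alternating `5 × 5` matrices, and the
resolvent identity prescribes the form `quadForm A`. Polarization turns it into candidate structure
constants that are integral polynomials in the entries of `A`. That they are commutative, have the
right form and are associative up to scalars are polynomial identities (`quadIdentities`). They hold
for the split ring, hence on its orbit under pairs `(g, h)` of a `4 × 4` and a `5 × 5` matrix
(`quadIdentities_orbit`). The orbit map is dominant, since its derivative at the identity is onto
the 40-dimensional space of quadruples (`tangent_eq`, `aeval_orbitQuad_injective`), so the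
identities hold for the generic `A` and therefore over every ring.

To pass to lattices, both modules are given bases up to a denominator `f` outside a given maximal
ideal (`QuasiBasis`). The scalars `r` for which `r` times the problem has a solution form an ideal.
The local computation puts a power of `f` into it, so the ideal contains `1`. In this way `β`, then
`B`, and in the uniqueness part `t`, are obtained globally. -/

theorem derivation_aeval [Fintype σ] (D : Derivation k B B) (Ψ : σ → B) (P : MvPolynomial σ k) :
    D (aeval Ψ P) = ∑ i, aeval Ψ (pderiv i P) * D (Ψ i) := by
  classical
  induction P using MvPolynomial.induction_on with
  | C a => simp
  | add p q hp hq => simp only [map_add, hp, hq, add_mul, Finset.sum_add_distrib]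
  | mul_X p j hp =>
    simp only [map_mul, aeval_X, Derivation.leibniz, hp, smul_eq_mul, pderiv_X, map_add]
    rw [add_comm]
    simp only [add_mul, Finset.sum_add_distrib, Finset.mul_sum]
    rw [add_comm]
    congr 1
    · rw [Finset.sum_eq_single j]
      · simp
      · intro i _ hij
        simp [hij.symm]
      · simp
    · exact Finset.sum_congr rfl fun i _ => by ring

theorem eq_C_of_pderiv_eq_zero [IsDomain k] [CharZero k] (P : MvPolynomial σ k)
    (h : ∀ i, pderiv i P = 0) : P = C (coeff 0 P) := by
  classical
  ext m
  rw [coeff_C]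
  split_ifs with hm
  · rw [← hm]
  · obtain ⟨i, hi⟩ : ∃ i, m i ≠ 0 := by
      by_contra! hc
      exact hm (Finsupp.ext fun i => (hc i).symm)
    have hle : Finsupp.single i 1 ≤ m := by
      rw [Finsupp.single_le_iff]
      omega
    have := congrArg (coeff (m - Finsupp.single i 1)) (h i)
    rw [coeff_pderiv, tsub_add_cancel_of_le hle, coeff_zero] at this
    exact (mul_eq_zero.mp this).resolve_right (Nat.cast_add_one_ne_zero _)

theorem totalDegree_pderiv_le (i : σ) (P : MvPolynomial σ k) :
    (pderiv i P).totalDegree ≤ P.totalDegree - 1 := by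
  classical
  rw [totalDegree, Finset.sup_le_iff]
  intro m hm
  rw [mem_support_iff, coeff_pderiv] at hm
  have hm' : m + Finsupp.single i 1 ∈ P.support := by
    rw [mem_support_iff]
    exact fun h => hm (by rw [h, zero_mul])
  have := le_totalDegree hm'
  rw [Finsupp.sum_add_index' (by simp) (by simp), Finsupp.sum_single_index rfl] at this
  omega

/-- If the Jacobian of `Ψ` with respect to some family of derivations is nonsingular, then the
family `Ψ` is algebraically independent. -/
theorem aeval_eq_zero_of_jacobian [Fintype σ] [DecidableEq σ] [IsDomain k] [CharZero k] [IsDomain B]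
    [FaithfulSMul k B] (Ψ : σ → B) (D : σ → Derivation k B B)
    (hD : (Matrix.of fun i j => D j (Ψ i)).det ≠ 0) (P : MvPolynomial σ k)
    (hP : aeval Ψ P = 0) : P = 0 := by
  induction hn : P.totalDegree using Nat.strong_induction_on generalizing P with
  | _ n ih =>
    have key : ∀ i, aeval Ψ (pderiv i P) = 0 := by
      -- Applying each derivation to the relation `P(Ψ) = 0` gives, by the chain rule, a homogeneous
      -- linear system for the `(∂ᵢP)(Ψ)` with the Jacobian as its matrix.
      have := Matrix.eq_zero_of_vecMul_eq_zero (v := fun i => aeval Ψ (pderiv i P)) hD (by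
        ext j
        have := derivation_aeval (D j) Ψ P
        rw [hP, map_zero] at this
        simpa [Matrix.vecMul, dotProduct] using this.symm)
      exact fun i => congrFun this i
    have hC : P = C (coeff 0 P) := by
      -- Differentiation lowers the degree only when the degree is positive, so constants are
      -- treated separately.
      rcases Nat.eq_zero_or_pos n with h0 | h0
      · exact (totalDegree_eq_zero_iff_eq_C).mp (hn.trans h0)
      · refine eq_C_of_pderiv_eq_zero P fun i => ?_
        refine ih _ ?_ _ (key i) rfl
        have := totalDegree_pderiv_le i P
        omega
    rw [hC, aeval_C] at hP
    rw [hC, (FaithfulSMul.algebraMap_eq_zero_iff k B).mp hP, C_0]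

end Jacobian

/-! ### Pfaffians and structure constants in coordinates -/

section Coordinates

variable {S : Type*} [CommRing S]

/-- The smaller index of the `r`-th pair in `01, 02, 03, 04, 12, 13, 14, 23, 24, 34`. -/
def pairFst : Fin 10 → Fin 5 := ![0, 0, 0, 0, 1, 1, 1, 2, 2, 3]

/-- The larger index of the `r`-th pair in `01, 02, 03, 04, 12, 13, 14, 23, 24, 34`. -/
def pairSnd : Fin 10 → Fin 5 := ![1, 2, 3, 4, 2, 3, 4, 3, 4, 4]

/-- The signed `4 × 4` Pfaffians of a `5 × 5` alternating matrix. -/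
def pfaffians (a : Fin 10 → S) : Fin 5 → S :=
  ![a 4 * a 9 - a 5 * a 8 + a 6 * a 7, -(a 1 * a 9 - a 2 * a 8 + a 3 * a 7),
    a 0 * a 9 - a 2 * a 6 + a 3 * a 5, -(a 0 * a 8 - a 1 * a 6 + a 3 * a 4),
    a 0 * a 7 - a 1 * a 5 + a 2 * a 4]

/-- The contraction of an alternating matrix with the Pfaffian vectors of two others. -/
def pfContract (a b c : Fin 10 → S) : S :=
  ∑ r, a r * (pfaffians b (pairFst r) * pfaffians c (pairSnd r) -
    pfaffians b (pairSnd r) * pfaffians c (pairFst r))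

/-- The determinant of four vectors in four-space, expanded along the first two rows. -/
def det4 (x y z w : Fin 4 → S) : S :=
  (x 0 * y 1 - x 1 * y 0) * (z 2 * w 3 - z 3 * w 2) -
  (x 0 * y 2 - x 2 * y 0) * (z 1 * w 3 - z 3 * w 1) +
  (x 0 * y 3 - x 3 * y 0) * (z 1 * w 2 - z 2 * w 1) +
  (x 1 * y 2 - x 2 * y 1) * (z 0 * w 3 - z 3 * w 0) -
  (x 1 * y 3 - x 3 * y 1) * (z 0 * w 2 - z 2 * w 0) +
  (x 2 * y 3 - x 3 * y 2) * (z 0 * w 1 - z 1 * w 0)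

theorem det_eq_det4 (x y z w : Fin 4 → S) : (Matrix.of ![x, y, z, w]).det = det4 x y z w := by
  simp [Matrix.det_succ_row_zero, Fin.sum_univ_succ, det4, Fin.succAbove]
  ring

/-- The fundamental form of a quadruple of alternating `5 × 5` matrices. -/
def quadForm (A : Matrix (Fin 4) (Fin 10) S) (x y z : Fin 4 → S) : S :=
  pfContract (Matrix.vecMul x A) (Matrix.vecMul y A) (Matrix.vecMul z A)

/-- The bilinear map with given structure constants. -/
def mulOfConst (c : Fin 4 → Fin 4 → Fin 4 → S) :
    (Fin 4 → S) →ₗ[S] (Fin 4 → S) →ₗ[S] (Fin 4 → S) :=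
  LinearMap.mk₂ S (fun x y k => ∑ i, ∑ j, x i * y j * c i j k)
    (fun x x' y => by ext k; simp [add_mul, Finset.sum_add_distrib])
    (fun r x y => by ext k; simp [Finset.mul_sum, mul_assoc])
    (fun x y y' => by ext k; simp [add_mul, mul_add, Finset.sum_add_distrib])
    (fun r x y => by ext k; simp [Finset.mul_sum, mul_assoc, mul_left_comm])

theorem mulOfConst_apply (c : Fin 4 → Fin 4 → Fin 4 → S) (x y : Fin 4 → S) (k : Fin 4) :
    mulOfConst c x y k = ∑ i, ∑ j, x i * y j * c i j k := rfl

/-- The `i`-th standard basis vector. -/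
abbrev basisVec (i : Fin 4) : Fin 4 → S := Pi.single i 1

/-- The index that completes three distinct indices to `{0, 1, 2, 3}`. -/
def fourth (i j k : Fin 4) : Fin 4 := 3 * (i + j + k) + 2

/-- The coefficient at `k` of the product of the distinct basis vectors `i` and `j`, where `k` is
a third index. -/
def constMixed (F : (Fin 4 → S) → (Fin 4 → S) → (Fin 4 → S) → S) (i j k : Fin 4) : S :=
  let x := basisVec (fourth i j k)
  det4 x (basisVec i) (basisVec j) (basisVec k) * F x (basisVec i) (basisVec j)

/-- The coefficient at `k ≠ i` of the square of the basis vector `i`. -/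
def constSquare (F : (Fin 4 → S) → (Fin 4 → S) → (Fin 4 → S) → S) (i k : Fin 4) : S :=
  let j := if k = i + 1 then i + 2 else i + 1
  let x := basisVec (fourth i j k)
  let y := basisVec i
  let z := basisVec j
  det4 x y z (basisVec k) * (F x y (y + z) - F x y z)

/-- The coefficient at `j ≠ i` of the product of the basis vectors `i` and `j`, normalized to be
zero for `j = i + 1`. -/
def constSide (F : (Fin 4 → S) → (Fin 4 → S) → (Fin 4 → S) → S) (i j : Fin 4) : S :=
  if j = i + 1 then 0 else
    let x := basisVec (fourth i j (i + 1))
    let y := basisVec i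
    let z := basisVec j
    let w := basisVec (i + 1)
    -- For `F x y z = x ∧ y ∧ z ∧ yz` the bracket keeps only the cross terms `-(x ∧ y ∧ w ∧ yz) - (x
    -- ∧ y ∧ z ∧ yw)`. After the sign these give the coefficient of `z` in `yz` minus that of `w` in
    -- `yw`; only this difference is independent of the lifts.
    det4 x y z w * (F x y z + F x y w - F x y (z + w))

/-- The coefficient at `i` of the square of the basis vector `i`. -/
def constSelf (F : (Fin 4 → S) → (Fin 4 → S) → (Fin 4 → S) → S) (i : Fin 4) : S :=
  let x := basisVec (i + 3)
  let y := basisVec (i + 1)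
  let z := basisVec (i + 2)
  let w := basisVec i
  -- Full polarization in the last two arguments. It yields the coefficient of `w` in `w²`, minus
  -- that of `z` in `wz`, minus that of `y` in `wy`; the final summand `constSide` replaces the
  -- middle one by a second copy of the last, which is the normalization.
  det4 x y z w * (F x (y + w) (z + w) - F x (y + w) z - F x (y + w) w - F x y (z + w) + F x y z +
    F x y w - F x w (z + w) + F x w z + F x w w) + constSide F i (i + 2)

/-- The normalized structure constants determined by the values of a fundamental form. -/
def structConst (F : (Fin 4 → S) → (Fin 4 → S) → (Fin 4 → S) → S) (i j k : Fin 4) : S :=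
  if i = j then (if k = i then constSelf F i else constSquare F i k)
  else if k = i then constSide F j i
  else if k = j then constSide F i j
  else constMixed F i j k

theorem det4_add_right (x y z w w' : Fin 4 → S) :
    det4 x y z (w + w') = det4 x y z w + det4 x y z w' := by
  simp only [det4, Pi.add_apply]; ring

/-- The structure constants of a commutative product are determined by its fundamental form up to
a change of lifts. -/
theorem structConst_det4 (β : (Fin 4 → S) →ₗ[S] (Fin 4 → S) →ₗ[S] (Fin 4 → S))
    (hβ : ∀ x y, β x y = β y x) (i j k : Fin 4) :
    structConst (fun x y z => det4 x y z (β y z)) i j k =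
      β (basisVec i) (basisVec j) k -
        ((if j = k then β (basisVec i) (basisVec (i + 1)) (i + 1) else 0) +
          (if i = k then β (basisVec j) (basisVec (j + 1)) (j + 1) else 0)) := by
  obtain ⟨b, hb⟩ : ∃ b : Fin 4 → Fin 4 → Fin 4 → S, ∀ i j, β (basisVec i) (basisVec j) = b i j :=
    ⟨_, fun _ _ => rfl⟩
  have hb' : ∀ i j, b i j = b j i := fun i j => by rw [← hb, hβ, hb]
  have h10 := hb' 1 0
  have h20 := hb' 2 0
  have h30 := hb' 3 0
  have h21 := hb' 2 1
  have h31 := hb' 3 1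
  have h32 := hb' 3 2
  simp only [structConst, constSelf, constSide, constSquare, constMixed, fourth, map_add,
    LinearMap.add_apply, hb]
  clear hb hb' hβ
  fin_cases i <;> fin_cases j <;> fin_cases k <;>
  simp [det4, h10, h20, h30, h21, h31, h32] <;> ring

end Coordinates

/-! ### Products with given form, change of lifts, and base change -/

section Bilinear

variable {S T : Type*} [CommRing S] [CommRing T]

theorem bilin_eq_mulOfConst (β : (Fin 4 → S) →ₗ[S] (Fin 4 → S) →ₗ[S] (Fin 4 → S)) :
    β = mulOfConst fun i j k => β (basisVec i) (basisVec j) k := by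
  refine LinearMap.pi_ext' fun i => LinearMap.ext_ring ?_
  refine LinearMap.pi_ext' fun j => LinearMap.ext_ring ?_
  ext k
  simp [mulOfConst_apply, Pi.single_apply]

/-- A commutative product is determined by its fundamental form up to a change of lifts. -/
theorem exists_eq_mulOfConst_add (β : (Fin 4 → S) →ₗ[S] (Fin 4 → S) →ₗ[S] (Fin 4 → S))
    (hβ : ∀ x y, β x y = β y x) (F : (Fin 4 → S) → (Fin 4 → S) → (Fin 4 → S) → S)
    (hF : ∀ x y z, det4 x y z (β y z) = F x y z) :
    ∃ t : (Fin 4 → S) →ₗ[S] S, ∀ y z,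
      β y z = mulOfConst (structConst F) y z + (t y • z + t z • y) := by
  obtain rfl : (fun x y z => det4 x y z (β y z)) = F := by
    funext x y z
    exact hF x y z
  -- The normalization makes the coefficient of `e_{i+1}` in `e_i e_{i+1}` vanish, so `t e_i` has to
  -- be that coefficient.
  refine ⟨Fintype.linearCombination S fun i => β (basisVec i) (basisVec (i + 1)) (i + 1),
    fun y z => ?_⟩
  ext k
  conv_lhs => rw [bilin_eq_mulOfConst β]
  simp only [mulOfConst_apply, structConst_det4 β hβ, Pi.add_apply, Pi.smul_apply, smul_eq_mul,
    Fintype.linearCombination_apply, mul_sub, mul_add, mul_ite, mul_zero, Finset.sum_sub_distrib,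
    Finset.sum_add_distrib, Finset.sum_ite_eq', Finset.mem_univ, if_true,
    Finset.sum_ite_irrel, Finset.sum_const_zero, Finset.sum_mul]
  have h1 : ∑ i, y i * z k * β (basisVec i) (basisVec (i + 1)) (i + 1) =
      ∑ i, y i * β (basisVec i) (basisVec (i + 1)) (i + 1) * z k :=
    Finset.sum_congr rfl fun i _ => by ring
  have h2 : ∑ i, y k * z i * β (basisVec i) (basisVec (i + 1)) (i + 1) =
      ∑ i, z i * β (basisVec i) (basisVec (i + 1)) (i + 1) * y k :=
    Finset.sum_congr rfl fun i _ => by ring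
  rw [h1, h2]
  ring

theorem mulOfConst_zero : mulOfConst (fun _ _ _ => (0 : S)) = 0 := by
  refine LinearMap.ext₂ fun x y => ?_
  ext k
  simp [mulOfConst_apply]

theorem structConst_zero : structConst (fun _ _ _ => (0 : S)) = fun _ _ _ => 0 := by
  funext i j k
  simp [structConst, constSelf, constSquare, constSide, constMixed]

theorem structConst_smul (r : S) (F : (Fin 4 → S) → (Fin 4 → S) → (Fin 4 → S) → S) :
    structConst (fun x y z => r * F x y z) = fun i j k => r * structConst F i j k := by
  funext i j k
  simp only [structConst, constSelf, constSquare, constSide, constMixed]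
  split_ifs <;> ring

theorem mulOfConst_smul (r : S) (c : Fin 4 → Fin 4 → Fin 4 → S) :
    mulOfConst (fun i j k => r * c i j k) = r • mulOfConst c := by
  refine LinearMap.ext₂ fun x y => ?_
  ext k
  simp only [mulOfConst_apply, LinearMap.smul_apply, Pi.smul_apply, smul_eq_mul, Finset.mul_sum]
  exact Finset.sum_congr rfl fun i _ => Finset.sum_congr rfl fun j _ => by ring

/-- The bilinear form `B` such that `(x y) z - x (y z) = B(y, z) x - B(x, y) z`, read off from the
structure constants of the product. -/
def assocForm (c : Fin 4 → Fin 4 → Fin 4 → S) : (Fin 4 → S) →ₗ[S] (Fin 4 → S) →ₗ[S] S :=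
  LinearMap.mk₂ S (fun x y => ∑ i, ∑ j, x i * y j *
      ∑ p, (c (j + 1) i p * c p j (j + 1) - c i j p * c (j + 1) p (j + 1)))
    (fun x x' y => by simp [add_mul, Finset.sum_add_distrib])
    (fun r x y => by simp [Finset.mul_sum, mul_assoc])
    (fun x y y' => by simp [add_mul, mul_add, Finset.sum_add_distrib])
    (fun r x y => by simp [Finset.mul_sum, mul_assoc, mul_left_comm])

theorem assocForm_apply (c : Fin 4 → Fin 4 → Fin 4 → S) (x y : Fin 4 → S) :
    assocForm c x y = ∑ i, ∑ j, x i * y j *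
      ∑ p, (c (j + 1) i p * c p j (j + 1) - c i j p * c (j + 1) p (j + 1)) := rfl

theorem mulOfConst_basisVec (c : Fin 4 → Fin 4 → Fin 4 → S) (i j : Fin 4) :
    mulOfConst c (basisVec i) (basisVec j) = c i j := by
  ext k
  simp [mulOfConst_apply, Pi.single_apply]

theorem mulOfConst_basisVec_left (c : Fin 4 → Fin 4 → Fin 4 → S) (i k : Fin 4) (y : Fin 4 → S) :
    mulOfConst c (basisVec i) y k = ∑ j, y j * c i j k := by
  simp [mulOfConst_apply, Pi.single_apply]

theorem mulOfConst_basisVec_right (c : Fin 4 → Fin 4 → Fin 4 → S) (j k : Fin 4) (x : Fin 4 → S) :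
    mulOfConst c x (basisVec j) k = ∑ i, x i * c i j k := by
  simp [mulOfConst_apply, Pi.single_apply]

/-- Take the triple `e_{j+1}, e_i, e_j` and read off the coordinate `j + 1`: the term in `z = e_j`
drops out and `B e_i e_j` remains. Hence the scalars are polynomials in the structure constants, and
associativity up to scalars becomes a polynomial identity. -/
theorem eq_assocForm (c : Fin 4 → Fin 4 → Fin 4 → S)
    (B : (Fin 4 → S) →ₗ[S] (Fin 4 → S) →ₗ[S] S)
    (h : ∀ x y z, mulOfConst c (mulOfConst c x y) z - mulOfConst c x (mulOfConst c y z) =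
      B y z • x - B x y • z) : B = assocForm c := by
  refine LinearMap.pi_ext' fun i => LinearMap.ext_ring ?_
  refine LinearMap.pi_ext' fun j => LinearMap.ext_ring ?_
  have hj : (j + 1 : Fin 4) ≠ j := by fin_cases j <;> decide
  have := congrFun (h (basisVec (j + 1)) (basisVec i) (basisVec j)) (j + 1)
  simp only [mulOfConst_basisVec, Pi.sub_apply, Pi.smul_apply, Pi.single_eq_same, smul_eq_mul,
    Pi.single_eq_of_ne hj, mul_zero, mul_one, sub_zero, mulOfConst_basisVec_left,
    mulOfConst_basisVec_right] at this
  simp only [LinearMap.coe_comp, Function.comp_apply, LinearMap.coe_single]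
  rw [← this, assocForm_apply]
  simp [Pi.single_apply]

section Naturality

variable (f : S →+* T)

theorem map_det4 (x y z w : Fin 4 → S) :
    f (det4 x y z w) = det4 (f ∘ x) (f ∘ y) (f ∘ z) (f ∘ w) := by
  simp [det4]

theorem map_pfaffians (a : Fin 10 → S) (i : Fin 5) :
    f (pfaffians a i) = pfaffians (f ∘ a) i := by
  fin_cases i <;> simp [pfaffians]

theorem map_pfContract (a b c : Fin 10 → S) :
    f (pfContract a b c) = pfContract (f ∘ a) (f ∘ b) (f ∘ c) := by
  simp [pfContract, map_pfaffians]

theorem comp_vecMul {m n : Type*} [Fintype m] (x : m → S) (A : Matrix m n S) :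
    f ∘ Matrix.vecMul x A = Matrix.vecMul (f ∘ x) (A.map f) := by
  ext i
  simp [Matrix.vecMul, dotProduct]

theorem map_quadForm (A : Matrix (Fin 4) (Fin 10) S) (x y z : Fin 4 → S) :
    f (quadForm A x y z) = quadForm (A.map f) (f ∘ x) (f ∘ y) (f ∘ z) := by
  simp only [quadForm, map_pfContract, comp_vecMul]

theorem comp_basisVec (i : Fin 4) : f ∘ basisVec i = basisVec i := by
  ext j
  simp only [Function.comp_apply, Pi.single_apply]
  split_ifs <;> simp

theorem comp_add {n : Type*} (x y : n → S) : f ∘ (x + y) = f ∘ x + f ∘ y := by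
  ext i
  simp

/-- The structure constants are integral combinations of values of the form at integral vectors, so
they commute with base change. -/
theorem map_structConst (F : (Fin 4 → S) → (Fin 4 → S) → (Fin 4 → S) → S)
    (F' : (Fin 4 → T) → (Fin 4 → T) → (Fin 4 → T) → T)
    (h : ∀ x y z, f (F x y z) = F' (f ∘ x) (f ∘ y) (f ∘ z)) (i j k : Fin 4) :
    f (structConst F i j k) = structConst F' i j k := by
  simp only [structConst, constSelf, constSquare, constSide, constMixed]
  split_ifs <;>
    simp only [map_add, map_sub, map_mul, map_zero, map_det4, h, comp_basisVec, comp_add]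

theorem comp_mulOfConst (c : Fin 4 → Fin 4 → Fin 4 → S) (c' : Fin 4 → Fin 4 → Fin 4 → T)
    (h : ∀ i j k, f (c i j k) = c' i j k) (x y : Fin 4 → S) :
    f ∘ mulOfConst c x y = mulOfConst c' (f ∘ x) (f ∘ y) := by
  ext k
  simp [mulOfConst_apply, h]

theorem map_assocForm (c : Fin 4 → Fin 4 → Fin 4 → S) (c' : Fin 4 → Fin 4 → Fin 4 → T)
    (h : ∀ i j k, f (c i j k) = c' i j k) (x y : Fin 4 → S) :
    f (assocForm c x y) = assocForm c' (f ∘ x) (f ∘ y) := by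
  simp [assocForm_apply, h]

end Naturality

/-- The product on four-space attached to a quadruple of alternating `5 × 5` matrices. -/
def quadMul (A : Matrix (Fin 4) (Fin 10) S) :
    (Fin 4 → S) →ₗ[S] (Fin 4 → S) →ₗ[S] (Fin 4 → S) :=
  mulOfConst (structConst (quadForm A))

/-- The scalar part of the product attached to a quadruple of alternating `5 × 5` matrices. -/
def quadScalar (A : Matrix (Fin 4) (Fin 10) S) : (Fin 4 → S) →ₗ[S] (Fin 4 → S) →ₗ[S] S :=
  assocForm (structConst (quadForm A))

theorem comp_quadMul (f : S →+* T) (A : Matrix (Fin 4) (Fin 10) S) (x y : Fin 4 → S) :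
    f ∘ quadMul A x y = quadMul (A.map f) (f ∘ x) (f ∘ y) :=
  comp_mulOfConst f _ _ (map_structConst f _ _ (map_quadForm f A)) x y

theorem map_quadScalar (f : S →+* T) (A : Matrix (Fin 4) (Fin 10) S) (x y : Fin 4 → S) :
    f (quadScalar A x y) = quadScalar (A.map f) (f ∘ x) (f ∘ y) :=
  map_assocForm f _ _ (map_structConst f _ _ (map_quadForm f A)) x y

/-- The identities that make the product attached to `A` the product of a quintic ring with
fundamental form `quadForm A`, at three given vectors. -/
structure QuadIdentities (A : Matrix (Fin 4) (Fin 10) S) (x y z : Fin 4 → S) : Prop where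
  comm : quadMul A y z = quadMul A z y
  det : det4 x y z (quadMul A y z) = quadForm A x y z
  assoc : quadMul A (quadMul A x y) z - quadMul A x (quadMul A y z) =
    quadScalar A y z • x - quadScalar A x y • z

theorem comp_sub_smul (f : S →+* T) (x z : Fin 4 → S) (a b : S) :
    f ∘ (a • x - b • z) = f a • (f ∘ x) - f b • (f ∘ z) := by
  ext i
  simp

theorem comp_sub (f : S →+* T) {n : Type*} (x y : n → S) : f ∘ (x - y) = f ∘ x - f ∘ y := by
  ext i
  simp

theorem QuadIdentities.map (f : S →+* T) {A : Matrix (Fin 4) (Fin 10) S} {x y z : Fin 4 → S}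
    (h : QuadIdentities A x y z) : QuadIdentities (A.map f) (f ∘ x) (f ∘ y) (f ∘ z) where
  comm := by rw [← comp_quadMul, h.comm, comp_quadMul]
  det := by rw [← comp_quadMul, ← map_det4, h.det, map_quadForm]
  assoc := by
    simp only [← comp_quadMul, ← map_quadScalar, ← comp_sub, ← comp_sub_smul, h.assoc]

/-- This descent along injections brings the identities from the generic orbit element to the
generic quadruple; `QuadIdentities.map` then specializes them to any ring. -/
theorem QuadIdentities.of_map (f : S →+* T) (hf : Function.Injective f)
    {A : Matrix (Fin 4) (Fin 10) S} {x y z : Fin 4 → S}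
    (h : QuadIdentities (A.map f) (f ∘ x) (f ∘ y) (f ∘ z)) : QuadIdentities A x y z where
  comm := hf.comp_left (by simpa only [comp_quadMul] using h.comm)
  det := hf (by simpa only [comp_quadMul, map_det4, map_quadForm] using h.det)
  assoc := hf.comp_left (by
    change f ∘ _ = f ∘ _
    rw [comp_sub_smul]
    simpa only [comp_quadMul, map_quadScalar, comp_sub] using h.assoc)

end Bilinear

/-- The scalar part of a product after a change of lifts. -/
theorem assoc_change_lift {R L : Type*} [CommRing R] [AddCommGroup L] [Module R L]
    (β β' : L →ₗ[R] L →ₗ[R] L) (B : L →ₗ[R] L →ₗ[R] R) (t : L →ₗ[R] R)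
    (hβ : ∀ x y z, β (β x y) z - β x (β y z) = B y z • x - B x y • z)
    (hβ' : ∀ y z, β' y z = β y z + (t y • z + t z • y)) (x y z : L) :
    β' (β' x y) z - β' x (β' y z) =
      (B y z - t (β y z) - t y * t z) • x - (B x y - t (β x y) - t x * t y) • z := by
  simp only [hβ', map_add, map_smul, LinearMap.add_apply, LinearMap.smul_apply, sub_smul]
  rw [← sub_eq_zero, ← sub_eq_zero.mpr (hβ x y z)]
  simp only [smul_add, smul_smul, add_smul, smul_eq_mul]
  module

/-- A commutative associative product whose fundamental form is `quadForm A` yields the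
identities for `A`. -/
theorem QuadIdentities.of_product {S : Type*} [CommRing S] (A : Matrix (Fin 4) (Fin 10) S)
    (β : (Fin 4 → S) →ₗ[S] (Fin 4 → S) →ₗ[S] (Fin 4 → S)) (hcomm : ∀ x y, β x y = β y x)
    (hassoc : ∀ x y z, β (β x y) z = β x (β y z))
    (hdet : ∀ x y z, det4 x y z (β y z) = quadForm A x y z) (x y z : Fin 4 → S) :
    QuadIdentities A x y z := by
  obtain ⟨t, ht⟩ := exists_eq_mulOfConst_add β hcomm _ hdet
  have ht' : ∀ y z, quadMul A y z = β y z + ((-t) y • z + (-t) z • y) := fun y z => by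
    rw [ht, quadMul, LinearMap.neg_apply, LinearMap.neg_apply]
    module
  -- Since `β` is strictly associative, its scalar form is `0`; passing to `quadMul A` is the change
  -- of lifts by `-t`, and the resulting scalars must be `quadScalar A` by `eq_assocForm`.
  have hA := assoc_change_lift β (quadMul A) 0 (-t) (fun x y z => by simp [hassoc]) ht'
  refine ⟨?_, ?_, ?_⟩
  · rw [ht', ht', hcomm, add_comm (_ • z)]
  · rw [ht', ← hdet, det4_add_right]
    simp only [add_eq_left, det4, Pi.add_apply, Pi.smul_apply, smul_eq_mul]
    ring
  · have hB := eq_assocForm (structConst (quadForm A))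
      (LinearMap.mk₂ S (fun x y => 0 - (-t) (β x y) - (-t) x * (-t) y)
        (fun x x' y => by simp; ring) (fun r x y => by simp; ring)
        (fun x y y' => by simp; ring) (fun r x y => by simp; ring)) hA
    rw [quadScalar, ← hB]
    exact hA x y z

/-! ### Exterior powers in coordinates -/

section Exterior

variable {R : Type*} [CommRing R] {M : Type*} [AddCommGroup M] [Module R M]

/-- Both sides are alternating in the rows of `C`, so they need only be compared on permutations of
the standard basis, where both are the same sign times `f m`. -/
theorem alternating_linearCombination {n : ℕ} {N : Type*} [AddCommGroup N] [Module R N]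
    (f : M [⋀^Fin n]→ₗ[R] N) (m : Fin n → M) (C : Matrix (Fin n) (Fin n) R) :
    f (fun i => ∑ j, C i j • m j) = C.det • f m := by
  have h : f.compLinearMap (Fintype.linearCombination R m) =
      (LinearMap.toSpanSingleton R N (f m)).compAlternatingMap Matrix.detRowAlternating := by
    refine Module.Basis.ext_alternating (Pi.basisFun R (Fin n)) fun v hv => ?_
    let σ := Equiv.ofBijective v (Finite.injective_iff_bijective.mp hv)
    have hσ : (fun i => Pi.basisFun R (Fin n) (v i)) = Pi.basisFun R (Fin n) ∘ σ := rfl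
    rw [hσ, AlternatingMap.map_perm, AlternatingMap.map_perm]
    congr 1
    simp only [AlternatingMap.compLinearMap_apply, LinearMap.compAlternatingMap_apply,
      LinearMap.toSpanSingleton_apply]
    have h1 : Matrix.detRowAlternating (R := R) ⇑(Pi.basisFun R (Fin n)) = 1 := by
      have : (Pi.basisFun R (Fin n) : Fin n → Fin n → R) = (1 : Matrix (Fin n) (Fin n) R) := by
        ext i j
        simp [Matrix.one_apply, Pi.single_apply, eq_comm]
      rw [this]
      exact Matrix.det_one
    rw [h1, one_smul]
    congr 1
    ext i
    simp
  have := congrArg (fun g => g C) h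
  simpa [Fintype.linearCombination_apply] using! this

theorem wedge₂_swap (v w : M) : wedge₂ (R := R) w v = -wedge₂ v w := by
  have h := wedge₂_self (R := R) (v + w)
  rw [wedge₂_add_left, wedge₂_add_right, wedge₂_add_right, wedge₂_self, wedge₂_self, zero_add,
    add_zero] at h
  exact eq_neg_of_add_eq_zero_right h

/-- The bivector with coordinates `a` with respect to five vectors `m`. -/
def bivector (m : Fin 5 → M) (a : Fin 10 → R) : ⋀[R]^2 M :=
  ∑ r, a r • wedge₂ (m (pairFst r)) (m (pairSnd r))

/-- The `2 × 2` minors of two rows. -/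
def minors (u v : Fin 5 → R) : Fin 10 → R := fun r =>
  u (pairFst r) * v (pairSnd r) - u (pairSnd r) * v (pairFst r)

theorem wedge₂_sum_sum (m : Fin 5 → M) (u v : Fin 5 → R) :
    wedge₂ (∑ i, u i • m i) (∑ i, v i • m i) = bivector m (minors u v) := by
  simp only [bivector, minors, Fin.sum_univ_succ, Fin.sum_univ_zero, add_zero, pairFst, pairSnd,
    wedge₂_add_left, wedge₂_add_right, wedge₂_smul_left, wedge₂_smul_right, wedge₂_self]
  simp [wedge₂_swap (m 0) (m 1), wedge₂_swap (m 0) (m 2), wedge₂_swap (m 0) (m 3),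
    wedge₂_swap (m 0) (m 4), wedge₂_swap (m 1) (m 2), wedge₂_swap (m 1) (m 3),
    wedge₂_swap (m 1) (m 4), wedge₂_swap (m 2) (m 3), wedge₂_swap (m 2) (m 4),
    wedge₂_swap (m 3) (m 4)]
  module

theorem wedgeVec_add_left (α β : ⋀[R]^4 M) (v : M) :
    wedgeVec (α + β) v = wedgeVec α v + wedgeVec β v :=
  Subtype.ext (add_mul _ _ _)

theorem wedgeVec_wedge₄ (a b c d v : M) :
    wedgeVec (wedge₄ (R := R) a b c d) v = exteriorPower.ιMulti R 5 ![a, b, c, d, v] := by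
  apply Subtype.ext
  simp [wedgeVec, wedge₄, ExteriorAlgebra.ιMulti_apply, mul_assoc]

/-- Grouping by the smaller index leaves four decomposable summands instead of ten, so that the box
has only six terms. -/
theorem bivector_eq_sum (m : Fin 5 → M) (a : Fin 10 → R) :
    bivector m a = ∑ i : Fin 4, wedge₂ (R := R)
      (∑ j, (Pi.single i.castSucc 1 : Fin 5 → R) j • m j)
      (∑ j, (![![0, a 0, a 1, a 2, a 3], ![0, 0, a 4, a 5, a 6], ![0, 0, 0, a 7, a 8],
        ![0, 0, 0, 0, a 9]] i : Fin 5 → R) j • m j) := by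
  simp [bivector, Fin.sum_univ_succ, pairFst, pairSnd, wedge₂_add_right, wedge₂_smul_right]
  module

theorem ιMulti_five (m : Fin 5 → M) (a b c d e : Fin 5 → R) :
    exteriorPower.ιMulti R 5 ![∑ j, a j • m j, ∑ j, b j • m j, ∑ j, c j • m j, ∑ j, d j • m j,
      ∑ j, e j • m j] = (Matrix.of ![a, b, c, d, e]).det • exteriorPower.ιMulti R 5 m := by
  rw [← alternating_linearCombination]
  congr 1
  ext i
  fin_cases i <;> rfl

theorem det_single_last (a b c d : Fin 5 → R) (k : Fin 5) :
    (Matrix.of ![a, b, c, d, Pi.single k 1]).det = (-1) ^ (k : ℕ) *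
      det4 (a ∘ k.succAbove) (b ∘ k.succAbove) (c ∘ k.succAbove) (d ∘ k.succAbove) := by
  have hlast : (Matrix.of ![a, b, c, d, Pi.single k 1]) 4 = Pi.single k 1 := rfl
  rw [Matrix.det_succ_row _ 4, Finset.sum_eq_single k, hlast, ← det_eq_det4]
  · have hsub : (Matrix.of ![a, b, c, d, Pi.single k 1]).submatrix (Fin.succAbove 4) k.succAbove =
        Matrix.of ![a ∘ k.succAbove, b ∘ k.succAbove, c ∘ k.succAbove, d ∘ k.succAbove] := by
      ext i j
      fin_cases i <;> rfl
    rw [hsub, Pi.single_eq_same, mul_one]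
    congr 1
    rw [pow_add]
    norm_num
  · intro j _ hj
    rw [hlast, Pi.single_eq_of_ne hj, mul_zero, zero_mul]
  · simp

theorem sum_det_eq_pfaffians (b : Fin 10 → R) (k : Fin 5) :
    let r : Fin 4 → Fin 5 → R := ![![0, b 0, b 1, b 2, b 3], ![0, 0, b 4, b 5, b 6],
      ![0, 0, 0, b 7, b 8], ![0, 0, 0, 0, b 9]]
    ∑ i : Fin 4, ∑ j ∈ Finset.Ioi i, (Matrix.of ![(Pi.single i.castSucc 1 : Fin 5 → R), r i,
      (Pi.single j.castSucc 1 : Fin 5 → R), r j, (Pi.single k 1 : Fin 5 → R)]).det = pfaffians b k := by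
  simp only [det_single_last, Fin.sum_univ_succ (n := 3), Fin.sum_univ_succ (n := 2),
    Fin.sum_univ_succ (n := 1), Fin.sum_univ_succ (n := 0), Fin.sum_univ_zero, Fin.sum_Ioi_zero,
    Fin.sum_Ioi_succ]
  fin_cases k <;> simp [pfaffians, det4, Fin.succAbove] <;> ring

theorem wedgeVec_sum {ι : Type*} (s : Finset ι) (α : ι → ⋀[R]^4 M) (v : M) :
    wedgeVec (∑ i ∈ s, α i) v = ∑ i ∈ s, wedgeVec (α i) v :=
  map_sum (AddMonoidHom.mk' (fun α => wedgeVec α v) fun _ _ => wedgeVec_add_left _ _ v) α s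

/-- This identifies the box with the vector of signed Pfaffians, viewing an element of `Λ⁴ M` as a
functional on `M` with values in `Λ⁵ M`. -/
theorem wedgeVec_box_bivector (m : Fin 5 → M) (b : Fin 10 → R) (k : Fin 5) :
    wedgeVec (box (bivector m b)) (m k) = pfaffians b k • exteriorPower.ιMulti R 5 m := by
  have hk : m k = ∑ j, (Pi.single k 1 : Fin 5 → R) j • m j := by
    simp [Pi.single_apply]
  rw [bivector_eq_sum, box_sum fun i : Fin 4 => (∑ j, (Pi.single i.castSucc 1 : Fin 5 → R) j • m j,
    ∑ j, (![![0, b 0, b 1, b 2, b 3], ![0, 0, b 4, b 5, b 6], ![0, 0, 0, b 7, b 8],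
        ![0, 0, 0, 0, b 9]] i : Fin 5 → R) j • m j), hk]
  simp only [boxSum, wedgeVec_sum, wedgeVec_wedge₄, ιMulti_five, ← Finset.sum_smul]
  rw [sum_det_eq_pfaffians b k]

/-- The contraction of bivectors, in coordinates. -/
theorem contract_bivector (m : Fin 5 → M) (a b c : Fin 10 → R) :
    contract (bivector m a) (box (bivector m b)) (box (bivector m c)) =
      pfContract a b c • (exteriorPower.ιMulti R 5 m ⊗ₜ[R] exteriorPower.ιMulti R 5 m) := by
  conv_lhs => rw [bivector, contract]
  simp only [map_sum, map_smul, pfContract, Finset.sum_smul]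
  refine Finset.sum_congr rfl fun r _ => ?_
  have := contract_wedge₂ (R := R) (m (pairFst r)) (m (pairSnd r)) (box (bivector m b))
    (box (bivector m c))
  rw [contract] at this
  rw [this]
  simp only [wedgeVec_box_bivector, TensorProduct.smul_tmul_smul]
  have hs (p q : R) (n : ⋀[R]^5 M ⊗[R] ⋀[R]^5 M) : a r • (p • n - q • n) = (a r * (p - q)) • n := by
    module
  exact hs _ _ _

end Exterior

/-! ### The split quintic ring and its orbit -/

section Covariance

variable {S : Type*} [CommRing S]

/-- The second compound of a `5 × 5` matrix. -/
def compound (h : Matrix (Fin 5) (Fin 5) S) : Matrix (Fin 10) (Fin 10) S :=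
  Matrix.of fun r => minors (h (pairFst r)) (h (pairSnd r))

theorem bivector_sum {M : Type*} [AddCommGroup M] [Module S M] (m : Fin 5 → M)
    (h : Matrix (Fin 5) (Fin 5) S) (a : Fin 10 → S) :
    bivector (fun i => ∑ j, h i j • m j) a = bivector m (Matrix.vecMul a (compound h)) := by
  simp only [bivector, wedge₂_sum_sum, Matrix.vecMul, dotProduct, compound, Matrix.of_apply,
    Finset.smul_sum, Finset.sum_smul, smul_smul]
  exact Finset.sum_comm

/-- The contraction in coordinates changes by the square of a determinant under a change of
basis. -/
theorem pfContract_compound (h : Matrix (Fin 5) (Fin 5) S) (a b c : Fin 10 → S) :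
    pfContract (Matrix.vecMul a (compound h)) (Matrix.vecMul b (compound h))
      (Matrix.vecMul c (compound h)) = h.det ^ 2 * pfContract a b c := by
  let m : Fin 5 → Fin 5 → S := Pi.basisFun S (Fin 5)
  let d : ⋀[S]^5 (Fin 5 → S) →ₗ[S] S :=
    exteriorPower.alternatingMapLinearEquiv Matrix.detRowAlternating
  have hd : d (exteriorPower.ιMulti S 5 m) = 1 := by
    have hm : m = (1 : Matrix (Fin 5) (Fin 5) S) := by
      ext i j
      simp [m, Matrix.one_apply, Pi.single_apply, eq_comm]
    rw [exteriorPower.alternatingMapLinearEquiv_apply_ιMulti, hm]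
    exact Matrix.det_one
  let q : ⋀[S]^5 (Fin 5 → S) ⊗[S] ⋀[S]^5 (Fin 5 → S) →ₗ[S] S :=
    LinearMap.mul' S S ∘ₗ TensorProduct.map d d
  -- The same contraction is computed twice, relative to the vectors `h m` and relative to `m`; the
  -- volume of `h m` is `det h` times that of `m` and occurs twice.
  have h1 := contract_bivector (fun i => ∑ j, h i j • m j) a b c
  rw [bivector_sum, bivector_sum, bivector_sum, contract_bivector,
    alternating_linearCombination] at h1
  have h2 := congrArg q h1
  simp only [map_smul, q, LinearMap.comp_apply, TensorProduct.map_tmul, LinearMap.mul'_apply,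
    hd, smul_eq_mul] at h2
  rw [mul_one, mul_one] at h2
  rw [h2]
  ring

theorem quadForm_mul_compound (A : Matrix (Fin 4) (Fin 10) S) (g : Matrix (Fin 4) (Fin 4) S)
    (h : Matrix (Fin 5) (Fin 5) S) (x y z : Fin 4 → S) :
    quadForm (g * A * compound h) x y z = h.det ^ 2 *
      quadForm A (Matrix.vecMul x g) (Matrix.vecMul y g) (Matrix.vecMul z g) := by
  simp only [quadForm, ← Matrix.vecMul_vecMul, pfContract_compound]

theorem det4_vecMul (g : Matrix (Fin 4) (Fin 4) S) (x y z w : Fin 4 → S) :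
    det4 (Matrix.vecMul x g) (Matrix.vecMul y g) (Matrix.vecMul z g) (Matrix.vecMul w g) =
      g.det * det4 x y z w := by
  rw [← det_eq_det4, ← det_eq_det4, mul_comm, ← Matrix.det_mul]
  congr 1
  ext i j
  fin_cases i <;> rfl

theorem det4_smul_right (r : S) (x y z w : Fin 4 → S) :
    det4 x y z (r • w) = r * det4 x y z w := by
  simp only [det4, Pi.smul_apply, smul_eq_mul]
  ring

/-- The adjugate stands in for `g⁻¹`: after multiplication by `det g` both sides are values of
`det4_vecMul`. This keeps the transported product polynomial in `g`. -/
theorem det4_vecMul_adjugate [IsDomain S] (g : Matrix (Fin 4) (Fin 4) S) (hg : g.det ≠ 0)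
    (x y z w : Fin 4 → S) :
    det4 x y z (Matrix.vecMul w g.adjugate) =
      det4 (Matrix.vecMul x g) (Matrix.vecMul y g) (Matrix.vecMul z g) w := by
  refine mul_left_cancel₀ hg ?_
  rw [← det4_vecMul, Matrix.vecMul_vecMul, Matrix.adjugate_mul, Matrix.vecMul_smul,
    Matrix.vecMul_one, det4_smul_right]

/-- The quadruple of alternating matrices of the split quintic ring. -/
def splitQuad : Matrix (Fin 4) (Fin 10) S :=
  Matrix.of ![![1, 0, 0, 0, 0, 0, 0, 0, 0, 0], ![0, 0, 0, 0, 0, 0, 0, 1, 0, 0],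
    ![0, 0, 0, 0, 1, 0, 1, 0, 1, 0], ![0, 0, -1, -1, 0, 0, 0, 0, 0, -1]]

theorem vecMul_splitQuad (x : Fin 4 → S) : Matrix.vecMul x splitQuad =
    ![x 0, 0, -x 3, -x 3, x 2, 0, x 2, x 1, x 2, -x 3] := by
  ext i
  fin_cases i <;> simp [splitQuad, Matrix.vecMul, dotProduct, Fin.sum_univ_succ]

/-- Here `y * z` is the componentwise product. It is the product of the split ring `S⁵` modulo `S`
when lifts are taken with one coordinate zero, so it is strictly associative. -/
theorem quadForm_splitQuad (x y z : Fin 4 → S) :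
    quadForm splitQuad x y z = det4 x y z (y * z) := by
  simp only [quadForm, vecMul_splitQuad]
  simp [pfContract, pfaffians, pairFst, pairSnd, Fin.sum_univ_succ, det4]
  ring

/-- The componentwise product is transported by `g`, with `adj g` in place of the inverse, and
scaled by `(det h)²`. It stays commutative and associative because `adj g * g` is scalar, and its
form is right by covariance of `quadForm` and `det4`. -/
theorem quadIdentities_orbit [IsDomain S] (g : Matrix (Fin 4) (Fin 4) S) (hg : g.det ≠ 0)
    (h : Matrix (Fin 5) (Fin 5) S) (x y z : Fin 4 → S) :
    QuadIdentities (g * (splitQuad : Matrix (Fin 4) (Fin 10) S) * compound h) x y z := by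
  refine QuadIdentities.of_product _ (LinearMap.mk₂ S (fun y z => h.det ^ 2 •
    Matrix.vecMul (Matrix.vecMul y g * Matrix.vecMul z g) g.adjugate)
    (fun x x' y => by simp only [Matrix.add_vecMul, add_mul, smul_add])
    (fun r x y => by
      simp only [Matrix.smul_vecMul, smul_mul_assoc, smul_comm r])
    (fun x y y' => by simp only [Matrix.add_vecMul, mul_add, smul_add])
    (fun r x y => by
      simp only [Matrix.smul_vecMul, mul_smul_comm, smul_comm r])) ?_ ?_ ?_ x y z
  · intro x y
    simp only [LinearMap.mk₂_apply, mul_comm]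
  · intro x y z
    simp only [LinearMap.mk₂_apply, Matrix.smul_vecMul, Matrix.vecMul_vecMul,
      Matrix.adjugate_mul, Matrix.vecMul_smul, Matrix.vecMul_one, smul_mul_assoc, mul_smul_comm,
      mul_assoc]
  · intro x y z
    simp only [LinearMap.mk₂_apply]
    rw [det4_smul_right, det4_vecMul_adjugate g hg, quadForm_mul_compound, quadForm_splitQuad]

end Covariance

/-! ### The tangent space of the split orbit -/

section Jacobian

/-- Coordinates of tangent vectors to `GL₄ × GL₅` that the infinitesimal action on `splitQuad` sends
to the standard basis. -/
def tangentTable : List (List ℤ) := [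
    [1],
    [-1, 0, 0, 0, 0, 0, 0, 0, 0, 0, -1, 0, 0, 0, 0, 0, 0, 0, 0, 0, 0, 0, 1, 1],
    [1, 0, 0, 0, 0, 1, 0, 0, 0, 0, 0, 0, 0, 0, 0, 1, -1, 0, 0, 0, 0, 0, 0, 0, 1, 0, 0, 0, 0, -1,
      0, 0, 0, 0, -1, 0, 0, 0, 0, 1],
    [1, 0, 0, 0, 0, 0, 0, 0, 0, 0, 1, 0, 0, 0, 0, 0, 0, 0, 0, 0, 0, 0, -1, 0, 0, 1],
    [-1, 0, 0, 0, 0, -1, 0, 0, 0, 0, -1, 0, 0, 0, 0, 0, 0, 0, -1, 0, 0, 0, 1, 0, 0, 0, 0, 0, 1,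
      0, 0, 0, 0, 1, 0, 0, 0, 0, -1],
    [1, 0, 0, 0, 0, 0, 0, 0, 0, 0, 0, 0, 0, 0, 0, 1, -1, 0, 0, -1],
    [-1, 0, 0, 0, 0, 0, 0, 0, 0, 0, 0, 0, 0, 0, 0, -1, 1, 0, 0, 0, -1],
    [0, 1],
    [2, 0, 1, 0, 0, 1, 0, 0, 0, 0, 1, 0, 0, 0, 0, 1, -1, 0, 1, 0, 1, 0, -1, 0, 0, 0, 0, 0, -1,
      0, 0, 0, 0, -1, 0, 0, 0, 0, 1],
    [-2, 0, 0, -1, 0, -1, 0, 0, 0, 0, -1, 0, 0, 0, 0, -1, 1, 0, 0, 0, 0, 0, 1, 0, -1, -1, 0, 0,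
      0, 1, 0, 0, 0, 0, 1, 0, 0, 0, 0, -1],
    [0, 0, 0, 0, 1],
    [0, 0, 0, 0, 0, 1, 0, 0, 0, 0, 0, 0, 0, 0, 0, 1, 0, 0, 0, 0, 0, 0, 0, 0, 0, 0, 0, 0, 0, 0,
      0, -1, 0, 0, -1],
    [1, 0, 0, 0, 0, 1, 0, 0, 0, 0, 0, 0, 0, 0, 0, 1, -1, 0, 0, 0, 0, -1, 0, 0, 0, 0, 1, 0, 0, 0,
      0, 0, 0, 0, -1, 0, -1],
    [-1, 0, 0, 0, 0, -2, 0, -1, 0, 0, -1, 0, 0, 0, 0, -1, 1, 0, 0, 0, 0, 1, 0, 0, 0, 0, -1, 0,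
      1, 0, 1, 0, 0, 0, 1, 0, 1],
    [-1, 0, 0, 0, 0, -1, 0, 0, 0, 0, -1, 0, 0, 0, 0, 0, 0, 1, 0, 0, 0, 0, 1, 0, 0, 0, 0, 0, 1,
      0, 0, 0, -1, 0, 0, 0, 0, 1],
    [0, 0, 0, 0, 0, -1, 0, 0, 0, 0, -1, 0, 0, 0, 0, 0, 0, 0, 0, 0, 0, 0, 0, 0, 0, 0, 0, 1, 1],
    [1, 0, 0, 0, 0, 2, 1, 0, 0, 0, 1, 0, 0, 0, 0, 1, 0, -1, 0, 0, 0, 0, -1, 0, 0, 0, 0, 0, -1,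
      0, 0, 0, 1, 0, -1, -1, 0, -1],
    [0, 0, 0, 0, 0, 1],
    [0, 0, 0, 0, 0, -1, 0, 0, 0, 0, 0, 0, 0, 0, 0, -1, 0, 0, 0, 0, 0, 0, 0, 0, 0, 0, 0, 0, 0, 0,
      0, 0, 0, 0, 1, 1],
    [0, 0, 0, 0, 0, 1, 0, 0, 0, 0, 1, 0, 0, 0, 0, 0, 0, 0, 0, 0, 0, 0, 0, 0, 0, 0, 0, 0, -1, 0,
      -1],
    [0, 0, 0, 0, 0, 0, 0, 0, 1],
    [1, 0, 0, 0, 0, 1, 0, 0, -1, 0, 0, 0, 0, 0, 0, 1, -1, 0, 0, 0, 0, 0, 0, 0, 0, 0, 0, 0, 0, 0,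
      0, 0, 0, 0, -1, 0, -1],
    [2, 0, 0, 0, 0, 2, 0, 0, -1, -1, 0, -1, 0, 0, 0, 2, -2, 0, 0, 0, 0, -1, 0, 0, 0, 0, 0, 0, 0,
      -1, 0, 0, 0, 0, -2, 0, -1, 0, 0, 1],
    [-1, 0, 0, 0, 0, -1, 0, 0, 1, 0, 0, 0, 0, 0, 0, -1, 1, 0, 0, 0, 0, 1, 0, 0, 0, 0, 0, 0, 0,
      0, 0, 0, 0, 0, 1, 0, 1],
    [-1, 0, 0, 0, 0, -1, 0, 0, 0, 0, -1, 0, 0, 0, 0, 0, 0, 0, 0, 0, 0, 0, 1, 0, 0, 0, 0, 0, 1],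
    [1, 0, 0, 0, 0, 1, 0, 0, 0, -1, 0, 0, 0, 0, 0, 1, -1, 0, 0, 0, 0, 0, 0, 0, 0, 0, 0, 0, 0, 0,
      0, 0, 0, 0, -1, 0, 0, 0, 0, 1],
    [0, 0, 0, 0, 0, 1, 0, 0, 0, 0, 1, 0, 0, 0, 0, 0, 0, 0, 0, 0, 0, 0, 0, 0, 0, 0, 0, 0, -1],
    [0, 0, 0, 0, 0, 0, 0, 0, 0, 1],
    [1, 0, 0, 0, 0, 0, 0, 0, 0, 0, 1, 0, 0, 0, 0, 0, 0, 0, 0, 0, 0, 0, -1],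
    [-1, 0, 0, 0, 0, -1, 0, 0, 0, 1, 0, 0, 0, 0, 0, -1, 1, 0, 0, 0, 0, 0, 0, 0, 0, 0, 0, 0, 0,
      1, 0, 0, 0, 0, 1, 0, 0, 0, 0, -1],
    [0, 0, 0, 0, 0, 0, 0, 0, 0, 0, 0, 0, 1],
    [-1, 0, 0, 0, 0, -1, 0, 0, 0, 0, -1, 0, 0, 1, 0, 0, 0, 0, 0, 0, 0, 0, 1, 0, 0, 0, 0, 0, 1,
      0, 0, 0, 0, 0, 0, 0, 0, 0, -1],
    [1, 0, 0, 0, 0, 1, 0, 0, 0, 0, 0, 0, 0, 0, 0, 1, -1, 0, 0, 0, 0, 0, 0, 0, 0, 0, 0, 0, 0, 0,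
      0, 0, 0, 0, -1],
    [0, 0, 0, 0, 0, -1, 0, 0, 0, 0, 0, 0, 0, 0, 0, -1, 0, 0, 0, 0, 0, 0, 0, 0, 0, 0, 0, 0, 0, 0,
      0, 0, 0, 0, 1],
    [-2, 0, 0, 0, 0, -2, 0, 0, 0, 0, -2, 0, 1, 1, 1, 0, 0, 1, 0, 0, 0, 0, 2, 0, 0, 0, 0, 0, 2,
      0, 0, 0, 0, 1, 0, 0, 0, 1, -1],
    [-1, 0, 0, 0, 0, -1, 0, 0, 0, 0, -1, 0, 1, 0, 0, 0, 0, 0, 0, 0, 0, 0, 1, 0, 0, 0, 0, 0, 1,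
      0, 0, 0, 0, 0, 0, 0, 0, 1],
    [1, 0, 0, 0, 0, 1, 0, 0, 0, 0, 1, 0, -1, 0, 0, 0, 0, -1, 0, 0, 0, 0, -1, 0, 0, 0, 0, 0, -1,
      0, 0, 0, 0, 0, 0, 0, 0, -1],
    [0, 0, 0, 0, 0, 0, 0, 0, 0, 0, 0, 0, 0, 1],
    [1, 0, 0, 0, 0, 1, 0, 0, 0, 0, 1, 0, 0, -1, 0, 0, 0, 0, 0, 0, 0, 0, -1, 0, 0, 0, 0, 0, -1,
      0, 0, 0, 0, -1, 0, 0, 0, 0, 1],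
    [-1, 0, 0, 0, 0, 0, 0, 0, 0, 0, 0, 0, 0, 0, 0, -1, 1]]

/-- The `GL₄`-component of a tangent vector of `tangentTable`. -/
def tangentLeft (j : Fin 4 × Fin 10) (p : Fin 4 × Fin 4) : ℤ :=
  -- The rows are numbered by the 40 entries of a quadruple. Each lists the 16 entries of the `4 ×
  -- 4` part, then the 25 of the `5 × 5` part, with trailing zeros omitted; hence the default `0`.
  (tangentTable.getD (10 * j.1 + j.2) []).getD (4 * p.1 + p.2) 0

/-- The `GL₅`-component of a tangent vector of `tangentTable`. -/
def tangentRight (j : Fin 4 × Fin 10) (p : Fin 5 × Fin 5) : ℤ :=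
  (tangentTable.getD (10 * j.1 + j.2) []).getD (16 + 5 * p.1 + p.2) 0

/-- The derivative of a second compound matrix at the identity. -/
def compoundDeriv (Y : Fin 5 × Fin 5 → ℤ) (s r : Fin 10) : ℤ :=
  (if pairSnd s = pairSnd r then Y (pairFst s, pairFst r) else 0) +
  (if pairFst s = pairFst r then Y (pairSnd s, pairSnd r) else 0) -
  (if pairSnd s = pairFst r then Y (pairFst s, pairSnd r) else 0) -
  (if pairFst s = pairSnd r then Y (pairSnd s, pairFst r) else 0)

/-- The derivative at the identity of `(g, h) ↦ g A Λ²h`, for `A` the split quadruple, sends `(X,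
Y)` to `X A + A dΛ²(Y)`. The table is an integral right inverse of this map from a space of
dimension 41 onto one of dimension 40. -/
theorem tangent_eq : ∀ j i : Fin 4 × Fin 10,
    ∑ l, tangentLeft j (i.1, l) * splitQuad l i.2 +
      ∑ s, splitQuad i.1 s * compoundDeriv (tangentRight j) s i.2 = if i = j then 1 else 0 := by
  decide +kernel

end Jacobian

/-! ### Dominance of the orbit map and the universal identities -/

section Universal

open MvPolynomial

theorem splitQuad_eq_intCast {S : Type*} [CommRing S] (l : Fin 4) (s : Fin 10) :
    (splitQuad l s : S) = ((splitQuad l s : ℤ) : S) := by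
  fin_cases l <;> fin_cases s <;> simp [splitQuad]

variable (k : Type*) [CommRing k]

/-- The coordinate ring of pairs of a `4 × 4` and a `5 × 5` matrix. -/
abbrev OrbitRing : Type _ := MvPolynomial (Fin 4 × Fin 4 ⊕ Fin 5 × Fin 5) k

/-- The generic `4 × 4` matrix. -/
def genericLeft : Matrix (Fin 4) (Fin 4) (OrbitRing k) := Matrix.of fun i j => X (Sum.inl (i, j))

/-- The generic `5 × 5` matrix. -/
def genericRight : Matrix (Fin 5) (Fin 5) (OrbitRing k) := Matrix.of fun i j => X (Sum.inr (i, j))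

/-- The generic element of the orbit of `splitQuad`. -/
def orbitQuad : Matrix (Fin 4) (Fin 10) (OrbitRing k) :=
  genericLeft k * (splitQuad : Matrix (Fin 4) (Fin 10) (OrbitRing k)) * compound (genericRight k)

/-- Evaluation at the pair of identity matrices. -/
def evalIdentity : OrbitRing k →ₐ[k] k :=
  aeval (Sum.elim (fun p => if p.1 = p.2 then 1 else 0) fun p => if p.1 = p.2 then 1 else 0)

theorem evalIdentity_genericLeft (i j : Fin 4) :
    evalIdentity k (genericLeft k i j) = if i = j then 1 else 0 := by
  simp [evalIdentity, genericLeft]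

theorem evalIdentity_genericRight (i j : Fin 5) :
    evalIdentity k (genericRight k i j) = if i = j then 1 else 0 := by
  simp [evalIdentity, genericRight]

/-- The derivation of the coordinate ring attached to a tangent vector of `tangentTable`. -/
def tangentDerivation (j : Fin 4 × Fin 10) : Derivation k (OrbitRing k) (OrbitRing k) :=
  mkDerivation k (Sum.elim (fun p => (tangentLeft j p : OrbitRing k))
    fun p => (tangentRight j p : OrbitRing k))

theorem tangentDerivation_genericLeft (j : Fin 4 × Fin 10) (a b : Fin 4) :
    tangentDerivation k j (genericLeft k a b) = (tangentLeft j (a, b) : OrbitRing k) := by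
  simp [tangentDerivation, genericLeft, mkDerivation_X]

theorem tangentDerivation_genericRight (j : Fin 4 × Fin 10) (a b : Fin 5) :
    tangentDerivation k j (genericRight k a b) = (tangentRight j (a, b) : OrbitRing k) := by
  simp [tangentDerivation, genericRight, mkDerivation_X]

theorem compound_one_apply (s r : Fin 10) :
    (if pairFst s = pairFst r then (1 : ℤ) else 0) * (if pairSnd s = pairSnd r then 1 else 0) -
      (if pairFst s = pairSnd r then 1 else 0) * (if pairSnd s = pairFst r then 1 else 0) =
    if s = r then 1 else 0 := by
  revert s r
  decide +kernel

theorem evalIdentity_compound (s r : Fin 10) :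
    evalIdentity k (compound (genericRight k) s r) = if s = r then 1 else 0 := by
  have := congrArg (Int.cast : ℤ → k) (compound_one_apply s r)
  push_cast at this
  rw [← this]
  simp [compound, minors, evalIdentity_genericRight]

theorem evalIdentity_tangentDerivation_compound (j : Fin 4 × Fin 10) (s r : Fin 10) :
    evalIdentity k (tangentDerivation k j (compound (genericRight k) s r)) =
      (compoundDeriv (tangentRight j) s r : k) := by
  simp only [compound, minors, Matrix.of_apply, map_sub, Derivation.leibniz, map_add, smul_eq_mul,
    map_mul, tangentDerivation_genericRight, evalIdentity_genericRight, map_intCast,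
    compoundDeriv, ite_mul, one_mul, zero_mul]
  push_cast
  ring

theorem evalIdentity_tangentDerivation (j i : Fin 4 × Fin 10) :
    evalIdentity k (tangentDerivation k j (orbitQuad k i.1 i.2)) = if i = j then 1 else 0 := by
  have h := congrArg (Int.cast : ℤ → k) (tangent_eq j i)
  push_cast at h
  rw [← h]
  simp only [orbitQuad, Matrix.mul_apply, map_sum, Derivation.leibniz, smul_eq_mul,
    splitQuad_eq_intCast (S := OrbitRing k), Derivation.map_intCast, mul_zero, zero_add, map_add,
    map_mul, evalIdentity_genericLeft, map_intCast, tangentDerivation_genericLeft,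
    evalIdentity_tangentDerivation_compound, evalIdentity_compound, Finset.sum_add_distrib,
    ite_mul, one_mul, zero_mul, Finset.sum_ite_eq, Finset.sum_ite_eq', Finset.mem_univ, if_true]
  rw [add_comm]
  congr 1
  exact Finset.sum_congr rfl fun l _ => mul_comm _ _

/-- At the pair of identity matrices the Jacobian along the derivations of the table is the identity
matrix, so its determinant is a nonzero polynomial and the 40 entries of the orbit element are
algebraically independent. -/
theorem aeval_orbitQuad_injective [IsDomain k] [CharZero k] :
    Function.Injective (aeval (R := k) fun i : Fin 4 × Fin 10 => orbitQuad k i.1 i.2) := by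
  rw [injective_iff_map_eq_zero]
  refine aeval_eq_zero_of_jacobian _ (tangentDerivation k) fun h => ?_
  have h1 := congrArg (evalIdentity k) h
  rw [map_zero, AlgHom.map_det] at h1
  have h2 : (evalIdentity k).mapMatrix
      (Matrix.of fun i j => tangentDerivation k j (orbitQuad k i.1 i.2)) = 1 := by
    ext i j
    simp [evalIdentity_tangentDerivation, Matrix.one_apply]
  rw [h2, Matrix.det_one] at h1
  exact one_ne_zero h1

theorem det_genericLeft_ne_zero [Nontrivial k] : (genericLeft k).det ≠ 0 := by
  intro h
  have h1 := congrArg (evalIdentity k) h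
  rw [map_zero, AlgHom.map_det] at h1
  have h2 : (evalIdentity k).mapMatrix (genericLeft k) = 1 := by
    ext i j
    simp [evalIdentity_genericLeft, Matrix.one_apply]
  rw [h2, Matrix.det_one] at h1
  exact one_ne_zero h1

/-- Every quadruple of alternating `5 × 5` matrices over a commutative ring satisfies the
identities for the product of a quintic ring. -/
theorem quadIdentities {S : Type*} [CommRing S] (A : Matrix (Fin 4) (Fin 10) S)
    (x y z : Fin 4 → S) : QuadIdentities A x y z := by
  -- The coordinates of `x, y, z` are adjoined to the base ring, so that substituting the orbit
  -- element for the generic quadruple leaves them fixed.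
  let k := MvPolynomial (Fin 3 × Fin 4) ℤ
  let U := MvPolynomial (Fin 4 × Fin 10) k
  let v (i : Fin 3) (j : Fin 4) : U := C (X (i, j))
  let A₀ : Matrix (Fin 4) (Fin 10) U := Matrix.of fun i j => X (i, j)
  have hU : QuadIdentities A₀ (v 0) (v 1) (v 2) := by
    refine QuadIdentities.of_map (aeval (R := k) fun i : Fin 4 × Fin 10 =>
      orbitQuad k i.1 i.2).toRingHom (aeval_orbitQuad_injective k) ?_
    have hA : A₀.map (aeval (R := k) fun i : Fin 4 × Fin 10 => orbitQuad k i.1 i.2).toRingHom =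
        orbitQuad k := by
      ext i j : 2
      simp [A₀]
    rw [hA]
    exact quadIdentities_orbit _ (det_genericLeft_ne_zero k) _ _ _ _
  let f : U →+* S := eval₂Hom (eval₂Hom (Int.castRingHom S) fun p => ![x, y, z] p.1 p.2)
    fun p => A p.1 p.2
  have hf := hU.map f
  have hA : A₀.map f = A := by
    ext i j
    exact eval₂Hom_X' _ _ _
  have hv (i : Fin 3) : f ∘ v i = ![x, y, z] i := by
    ext j
    exact (eval₂Hom_C _ _ _).trans (eval₂Hom_X' _ _ _)
  simpa only [hA, hv] using! hf

end Universal

/-! ### Local bases of lattices -/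

section QuasiBasis

variable {R : Type*} [CommRing R] {L : Type*} [AddCommGroup L] [Module R L]

/-- Vectors `e i` and coordinates `b` that become dual bases after inverting `f`. -/
structure QuasiBasis (R L : Type*) [CommRing R] [AddCommGroup L] [Module R L] (n : ℕ) (f : R) where
  /-- the vectors -/
  vec : Fin n → L
  /-- the coordinates -/
  coord : L →ₗ[R] (Fin n → R)
  sum_coord : ∀ x, ∑ i, coord x i • vec i = f • x
  coord_vec : ∀ i, coord (vec i) = f • Pi.single i 1

/-- Rescaling the coordinates of a quasi-basis. -/
def QuasiBasis.scale {n : ℕ} {f : R} (q : QuasiBasis R L n f) (r : R) :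
    QuasiBasis R L n (r * f) where
  vec := q.vec
  coord := r • q.coord
  sum_coord x := by
    simp only [LinearMap.smul_apply, Pi.smul_apply, smul_assoc, ← Finset.smul_sum, q.sum_coord,
      mul_smul]
  coord_vec i := by
    rw [LinearMap.smul_apply, q.coord_vec, mul_smul]

/-- The localization at `p` is free. By finite presentation the coordinate isomorphism and its
inverse lift, after multiplication by some `s` and `t` outside `p`, to maps between `L` and the free
module over `R`. Their composites are multiplication by `s * t`, as can be checked in the
localizations because nothing is torsion. -/
theorem IsLatticeOfRank.exists_quasiBasis [IsDedekindDomain R] {n : ℕ}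
    (hL : IsLatticeOfRank R L n) (p : Ideal R) [p.IsMaximal] :
    ∃ f ∉ p, Nonempty (QuasiBasis R L n f) := by
  have := hL.finite
  have := hL.torsionFree
  let Rp := Localization.AtPrime p
  let Lp := LocalizedModule p.primeCompl L
  let g : L →ₗ[R] Lp := LocalizedModule.mkLinearMap p.primeCompl L
  have hle : p.primeCompl ≤ nonZeroDivisors R := p.primeCompl_le_nonZeroDivisors
  have : Module.Finite Rp Lp := Module.Finite.of_isLocalizedModule p.primeCompl g
  have : Module.Flat Rp Lp := inferInstance
  have : Module.Free Rp Lp := Module.free_of_flat_of_isLocalRing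
  have hrank : Module.finrank Rp Lp = n := by
    rw [← hL.finrank_eq]
    exact (IsLocalization.finrank_eq Rp p.primeCompl hle).trans
      (IsLocalizedModule.finrank_eq p.primeCompl g hle)
  let c := Module.finBasisOfFinrankEq Rp Lp hrank
  let ι : (Fin n →₀ R) →ₗ[R] (Fin n →₀ Rp) :=
    Finsupp.mapRange.linearMap (Algebra.linearMap R Rp)
  have hg : Function.Injective g := by
    intro x y hxy
    obtain ⟨s, hs⟩ := IsLocalizedModule.exists_of_eq (S := p.primeCompl) (f := g) hxy
    have hs' : (s : R) • x = (s : R) • y := hs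
    exact smul_right_injective L (nonZeroDivisors.ne_zero (hle s.2)) hs'
  have hι : Function.Injective ι :=
    Finsupp.mapRange_injective _ (map_zero _) (IsLocalization.injective Rp hle)
  have : Module.FinitePresentation R L := Module.finitePresentation_of_finite R L
  obtain ⟨b, s, hb⟩ := Module.FinitePresentation.exists_lift_of_isLocalizedModule p.primeCompl ι
    ((c.repr.toLinearMap.restrictScalars R) ∘ₗ g)
  obtain ⟨a, t, ha⟩ := Module.FinitePresentation.exists_lift_of_isLocalizedModule p.primeCompl g
    ((c.repr.symm.toLinearMap.restrictScalars R) ∘ₗ ι)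
  have hb' x : ι (b x) = (s : R) • c.repr (g x) := LinearMap.congr_fun hb x
  have ha' x : g (a x) = (t : R) • c.repr.symm (ι x) := LinearMap.congr_fun ha x
  have hsymm (r : R) (y : Fin n →₀ Rp) : c.repr.symm (r • y) = r • c.repr.symm y :=
    map_smul (c.repr.symm.toLinearMap.restrictScalars R) r y
  have hrepr (r : R) (y : Lp) : c.repr (r • y) = r • c.repr y :=
    map_smul (c.repr.toLinearMap.restrictScalars R) r y
  have hab x : a (b x) = ((s : R) * t) • x := hg (by
    rw [ha', hb', hsymm, LinearEquiv.symm_apply_apply, smul_smul, map_smul, mul_comm])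
  have hba x : b (a x) = ((s : R) * t) • x := hι (by
    rw [hb', ha', hrepr, LinearEquiv.apply_symm_apply, smul_smul, map_smul])
  refine ⟨s * t, fun h => ?_, ⟨⟨fun i => a (Finsupp.single i 1),
    (Finsupp.linearEquivFunOnFinite R R (Fin n)).toLinearMap ∘ₗ b, fun x => ?_, fun i => ?_⟩⟩⟩
  · exact ((Ideal.IsMaximal.isPrime ‹_›).mem_or_mem h).elim s.2 t.2
  · rw [← hab]
    simp only [← map_smul, ← map_sum]
    congr 1
    ext j
    simp
  · ext j
    rcases eq_or_ne i j with rfl | hij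
    · simp [hba]
    · simp [hba, Finsupp.single_eq_of_ne hij.symm, Pi.single_eq_of_ne hij.symm]

/-- An ideal that contains, for every maximal ideal, an element outside of it is everything. -/
theorem ideal_eq_top_of_forall_exists_notMem (I : Ideal R)
    (h : ∀ p : Ideal R, p.IsMaximal → ∃ f ∉ p, f ∈ I) : I = ⊤ := by
  by_contra hI
  obtain ⟨p, hp, hIp⟩ := Ideal.exists_le_maximal I hI
  obtain ⟨f, hf, hfI⟩ := h p hp
  exact hf (hIp hfI)

end QuasiBasis

/-! ### The fundamental form of `(φ, θ)` -/

section FundamentalForm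

variable {R : Type*} [CommRing R] {L : Type*} [AddCommGroup L] [Module R L]
  {M : Type*} [AddCommGroup M] [Module R M]

theorem box_smul (r : R) (μ : ⋀[R]^2 M) : box (r • μ) = r ^ 2 • box μ := by
  obtain ⟨n, p, rfl⟩ := exists_sum_wedge₂ μ
  have h : r • ∑ i, wedge₂ (R := R) (p i).1 (p i).2 =
      ∑ i, wedge₂ (R := R) (r • (p i).1) (p i).2 := by
    simp only [Finset.smul_sum, wedge₂_smul_left]
  rw [h, box_sum, box_sum fun i => (r • (p i).1, (p i).2)]
  simp only [boxSum, Finset.smul_sum, ← wedge_wedge₂, wedge₂_smul_left, map_smul,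
    LinearMap.smul_apply, smul_smul, pow_two]

theorem wedgeVec_smul_left (r : R) (α : ⋀[R]^4 M) : wedgeVec (r • α) = r • wedgeVec α :=
  LinearMap.ext fun _ => Subtype.ext (smul_mul_assoc _ _ _)

theorem contract_smul (r s t : R) (μ : ⋀[R]^2 M) (α β : ⋀[R]^4 M) :
    contract (r • μ) (s • α) (t • β) = (r * s * t) • contract μ α β := by
  obtain ⟨n, p, rfl⟩ := exists_sum_wedge₂ μ
  have key (γ δ : ⋀[R]^4 M) (c : R) :
      contract (c • ∑ i, wedge₂ (R := R) (p i).1 (p i).2) γ δ =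
        c • ∑ i, contract (wedge₂ (p i).1 (p i).2) γ δ := by
    simp only [contract, map_smul, map_sum]
  have key' := key α β 1
  rw [one_smul, one_smul] at key'
  rw [key, key', Finset.smul_sum, Finset.smul_sum]
  refine Finset.sum_congr rfl fun i _ => ?_
  have hs (u v : ⋀[R]^5 M ⊗[R] ⋀[R]^5 M) :
      r • ((s * t) • u - (s * t) • v) = (r * s * t) • (u - v) := by
    module
  simp only [contract_wedge₂, wedgeVec_smul_left, LinearMap.smul_apply,
    TensorProduct.smul_tmul_smul]
  exact hs _ _

/-- The left-hand side of the resolvent identity. -/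
def fundForm (φ : ⋀[R]^4 L ⊗[R] L →ₗ[R] ⋀[R]^2 M) (θ : ⋀[R]^5 M →ₗ[R] ⨂[R]^3 (⋀[R]^4 L))
    (l₁ l₂ l₃ : ⋀[R]^4 L) (x y z : L) : ⨂[R]^6 (⋀[R]^4 L) :=
  thetaSq θ (contract (φ (l₁ ⊗ₜ x)) (box (φ (l₂ ⊗ₜ y))) (box (φ (l₃ ⊗ₜ z))))

theorem fundForm_smul (φ : ⋀[R]^4 L ⊗[R] L →ₗ[R] ⋀[R]^2 M)
    (θ : ⋀[R]^5 M →ₗ[R] ⨂[R]^3 (⋀[R]^4 L)) (a₁ a₂ a₃ r₁ r₂ r₃ : R)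
    (l₁ l₂ l₃ : ⋀[R]^4 L) (x y z : L) :
    fundForm φ θ (a₁ • l₁) (a₂ • l₂) (a₃ • l₃) (r₁ • x) (r₂ • y) (r₃ • z) =
      (a₁ * r₁ * (a₂ * r₂) ^ 2 * (a₃ * r₃) ^ 2) • fundForm φ θ l₁ l₂ l₃ x y z := by
  simp only [fundForm, TensorProduct.smul_tmul_smul, map_smul, box_smul, contract_smul]

/-- The product `l₁ l₂² l₃² w` in `(Λ⁴ L)^{⊗ 6}`. -/
def detForm (l₁ l₂ l₃ : ⋀[R]^4 L) : ⋀[R]^4 L →ₗ[R] ⨂[R]^6 (⋀[R]^4 L) :=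
  (PiTensorProduct.tprod R).toLinearMap ![l₁, l₂, l₂, l₃, l₃, 0] 5

theorem detForm_apply (l₁ l₂ l₃ w : ⋀[R]^4 L) :
    detForm l₁ l₂ l₃ w = PiTensorProduct.tprod R ![l₁, l₂, l₂, l₃, l₃, w] := by
  rw [detForm, MultilinearMap.toLinearMap_apply]
  congr 1
  ext i : 1
  fin_cases i <;> rfl

theorem detForm_smul (a₁ a₂ a₃ : R) (l₁ l₂ l₃ w : ⋀[R]^4 L) :
    detForm (a₁ • l₁) (a₂ • l₂) (a₃ • l₃) w =
      (a₁ * a₂ ^ 2 * a₃ ^ 2) • detForm l₁ l₂ l₃ w := by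
  have h : ![a₁ • l₁, a₂ • l₂, a₂ • l₂, a₃ • l₃, a₃ • l₃, w] =
      fun i => ![a₁, a₂, a₂, a₃, a₃, 1] i • ![l₁, l₂, l₂, l₃, l₃, w] i := by
    ext i : 1
    fin_cases i <;> simp
  rw [detForm_apply, h, MultilinearMap.map_smul_univ, detForm_apply]
  congr 1
  simp [Fin.prod_univ_succ]
  ring

/-- `w ↦ x ∧ y ∧ z ∧ w` as a linear map. -/
def wedgeLast (x y z : L) : L →ₗ[R] ⋀[R]^4 L :=
  (exteriorPower.ιMulti R 4 (M := L)).toMultilinearMap.toLinearMap ![x, y, z, 0] 3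

theorem wedgeLast_apply (x y z w : L) : wedgeLast (R := R) x y z w = wedge₄ x y z w := by
  rw [wedgeLast, MultilinearMap.toLinearMap_apply]
  change exteriorPower.ιMulti R 4 _ = exteriorPower.ιMulti R 4 _
  congr 1
  ext i : 1
  fin_cases i <;> rfl

/-- The product `β` on `L` has `r` times the fundamental form of `(φ, θ)`. -/
def HasForm (φ : ⋀[R]^4 L ⊗[R] L →ₗ[R] ⋀[R]^2 M) (θ : ⋀[R]^5 M →ₗ[R] ⨂[R]^3 (⋀[R]^4 L))
    (r : R) (β : L →ₗ[R] L →ₗ[R] L) : Prop :=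
  ∀ l₁ l₂ l₃ x y z, r • fundForm φ θ l₁ l₂ l₃ x y z = detForm l₁ l₂ l₃ (wedgeLast x y z (β y z))

/-- The form is linear in the product. Hence the scalars `r` admitting a product form an ideal, and
two products with the same form differ by one with form zero. -/
theorem HasForm.add {φ : ⋀[R]^4 L ⊗[R] L →ₗ[R] ⋀[R]^2 M}
    {θ : ⋀[R]^5 M →ₗ[R] ⨂[R]^3 (⋀[R]^4 L)} {r s : R} {β γ : L →ₗ[R] L →ₗ[R] L}
    (hβ : HasForm φ θ r β) (hγ : HasForm φ θ s γ) : HasForm φ θ (r + s) (β + γ) := by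
  intro l₁ l₂ l₃ x y z
  rw [add_smul, hβ, hγ, LinearMap.add_apply, LinearMap.add_apply, map_add, map_add]

theorem HasForm.smul {φ : ⋀[R]^4 L ⊗[R] L →ₗ[R] ⋀[R]^2 M}
    {θ : ⋀[R]^5 M →ₗ[R] ⨂[R]^3 (⋀[R]^4 L)} {r : R} {β : L →ₗ[R] L →ₗ[R] L}
    (hβ : HasForm φ θ r β) (s : R) : HasForm φ θ (s * r) (s • β) := by
  intro l₁ l₂ l₃ x y z
  rw [mul_smul, hβ, LinearMap.smul_apply, LinearMap.smul_apply, map_smul, map_smul]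

theorem HasForm.sub {φ : ⋀[R]^4 L ⊗[R] L →ₗ[R] ⋀[R]^2 M}
    {θ : ⋀[R]^5 M →ₗ[R] ⨂[R]^3 (⋀[R]^4 L)} {r s : R} {β γ : L →ₗ[R] L →ₗ[R] L}
    (hβ : HasForm φ θ r β) (hγ : HasForm φ θ s γ) : HasForm φ θ (r - s) (β - γ) := by
  have h := hβ.add (hγ.smul (-1))
  have hsub : β + (-1 : R) • γ = β - γ :=
    LinearMap.ext₂ fun x y => by simp [sub_eq_add_neg]
  rwa [neg_one_mul, ← sub_eq_add_neg, hsub] at h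

end FundamentalForm

/-! ### The fundamental form in local coordinates -/

section Local

variable {R : Type*} [CommRing R] {L : Type*} [AddCommGroup L] [Module R L]
  {M : Type*} [AddCommGroup M] [Module R M]

namespace QuasiBasis

variable {n : ℕ} {f : R}

/-- The linear combination of the vectors of a quasi-basis with given coefficients. -/
def comb (q : QuasiBasis R L n f) : (Fin n → R) →ₗ[R] L := Fintype.linearCombination R q.vec

theorem comb_apply (q : QuasiBasis R L n f) (ξ : Fin n → R) :
    q.comb ξ = ∑ i, ξ i • q.vec i := Fintype.linearCombination_apply _ _ _

theorem comb_coord (q : QuasiBasis R L n f) (x : L) : q.comb (q.coord x) = f • x := by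
  rw [comb_apply, q.sum_coord]

theorem coord_comb (q : QuasiBasis R L n f) (ξ : Fin n → R) : q.coord (q.comb ξ) = f • ξ := by
  rw [comb_apply, map_sum]
  simp only [map_smul, q.coord_vec]
  ext i
  simp [Finset.sum_apply, Pi.single_apply, mul_comm]

/-- The wedge product of the vectors of a quasi-basis. -/
def vol (q : QuasiBasis R L n f) : ⋀[R]^n L := exteriorPower.ιMulti R n q.vec

/-- The determinant in the coordinates of a quasi-basis. -/
def det (q : QuasiBasis R L n f) : ⋀[R]^n L →ₗ[R] R :=
  exteriorPower.alternatingMapLinearEquiv (Matrix.detRowAlternating.compLinearMap q.coord)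

theorem det_ιMulti (q : QuasiBasis R L n f) (v : Fin n → L) :
    q.det (exteriorPower.ιMulti R n v) = (Matrix.of fun i => q.coord (v i)).det := by
  rw [det, exteriorPower.alternatingMapLinearEquiv_apply_ιMulti]
  rfl

/-- Expanding each `f • vᵢ` in the quasi-basis shows that the top exterior power is generated by
`q.vol` up to the denominator `f ^ n`. -/
theorem smul_eq_det_smul_vol (q : QuasiBasis R L n f) (l : ⋀[R]^n L) :
    f ^ n • l = q.det l • q.vol := by
  have h : f ^ n • LinearMap.id = q.det.smulRight q.vol := by
    refine exteriorPower.linearMap_ext ?_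
    ext v : 1
    change f ^ n • exteriorPower.ιMulti R n v = q.det (exteriorPower.ιMulti R n v) • q.vol
    rw [det_ιMulti, vol, ← alternating_linearCombination]
    have hv : (fun i => ∑ j, (Matrix.of fun i => q.coord (v i)) i j • q.vec j) =
        fun i => f • v i := by
      ext i
      exact q.sum_coord (v i)
    rw [hv, AlternatingMap.map_smul_univ]
    simp
  exact LinearMap.congr_fun h l

theorem det_vol (q : QuasiBasis R L n f) : q.det q.vol = f ^ n := by
  rw [vol, det_ιMulti]
  have : (Matrix.of fun i => q.coord (q.vec i)) = f • (1 : Matrix (Fin n) (Fin n) R) := by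
    ext i j
    simp [q.coord_vec, Matrix.one_apply, Pi.single_apply, eq_comm]
  rw [this, Matrix.det_smul, Matrix.det_one, mul_one, Fintype.card_fin]

theorem ιMulti_comb (q : QuasiBasis R L n f) (C : Matrix (Fin n) (Fin n) R) :
    exteriorPower.ιMulti R n (fun i => q.comb (C i)) = C.det • q.vol := by
  rw [vol, ← alternating_linearCombination]
  simp only [comb_apply]

theorem exists_tprod_eq (q : QuasiBasis R L n f) {k : ℕ} (u : ⨂[R]^k (⋀[R]^n L)) :
    ∃ t : R, (f ^ n) ^ k • u = t • PiTensorProduct.tprod R fun _ => q.vol := by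
  induction u using PiTensorProduct.induction_on with
  | smul_tprod r v =>
    refine ⟨r * ∏ i, q.det (v i), ?_⟩
    have h := (PiTensorProduct.tprod R).map_smul_univ (fun _ : Fin k => f ^ n) v
    rw [Finset.prod_const, Finset.card_univ, Fintype.card_fin] at h
    rw [smul_comm, ← h, mul_smul, ← MultilinearMap.map_smul_univ]
    exact congrArg (r • ·) (congrArg (PiTensorProduct.tprod R)
      (funext fun i => q.smul_eq_det_smul_vol (v i)))
  | add u v hu hv =>
    obtain ⟨s, hs⟩ := hu
    obtain ⟨t, ht⟩ := hv
    exact ⟨s + t, by rw [smul_add, hs, ht, add_smul]⟩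

/-- The product of the determinants of the factors of a tensor. -/
def detTensor (q : QuasiBasis R L n f) (k : ℕ) : ⨂[R]^k (⋀[R]^n L) →ₗ[R] R :=
  PiTensorProduct.lift ((MultilinearMap.mkPiAlgebra R (Fin k) R).compLinearMap fun _ => q.det)

theorem detTensor_tprod (q : QuasiBasis R L n f) {k : ℕ} (v : Fin k → ⋀[R]^n L) :
    q.detTensor k (PiTensorProduct.tprod R v) = ∏ i, q.det (v i) := by
  simp [detTensor]

end QuasiBasis

end Local

/-! ### Comparison of the form on the lattice with its coordinate expression -/

section LocalForm

variable {R : Type*} [CommRing R] {L : Type*} [AddCommGroup L] [Module R L]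
  {M : Type*} [AddCommGroup M] [Module R M] {f : R}

theorem bivector_vecMul {k : Type*} [Fintype k] (m : Fin 5 → M) (ξ : k → R)
    (A : Matrix k (Fin 10) R) :
    bivector m (Matrix.vecMul ξ A) = ∑ i, ξ i • bivector m (fun r => A i r) := by
  simp only [bivector, Matrix.vecMul, dotProduct, Finset.smul_sum, Finset.sum_smul, smul_smul]
  exact Finset.sum_comm

theorem QuasiBasis.exists_bivector (m : QuasiBasis R M 5 f) (μ : ⋀[R]^2 M) :
    ∃ a : Fin 10 → R, f ^ 2 • μ = bivector m.vec a := by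
  obtain ⟨n, p, rfl⟩ := exists_sum_wedge₂ μ
  refine ⟨Matrix.vecMul (fun _ => 1)
    (Matrix.of fun i : Fin n => minors (m.coord (p i).1) (m.coord (p i).2)), ?_⟩
  rw [bivector_vecMul, Finset.smul_sum]
  refine Finset.sum_congr rfl fun i _ => ?_
  simp only [Matrix.of_apply]
  rw [← wedge₂_sum_sum, m.sum_coord, m.sum_coord, wedge₂_smul_left,
    wedge₂_smul_right, one_smul, smul_smul, pow_two]

theorem thetaSq_tmul (θ : ⋀[R]^5 M →ₗ[R] ⨂[R]^3 (⋀[R]^4 L)) (a b : ⋀[R]^5 M) :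
    thetaSq θ (a ⊗ₜ b) = TensorPower.mulEquiv (R := R) (n := 3) (m := 3) (θ a ⊗ₜ θ b) := rfl

theorem mulEquiv_tprod_const (v : ⋀[R]^4 L) :
    TensorPower.mulEquiv (R := R) (n := 3) (m := 3)
      ((PiTensorProduct.tprod R fun _ => v) ⊗ₜ (PiTensorProduct.tprod R fun _ => v)) =
      detForm v v v v := by
  refine (TensorPower.tprod_mul_tprod R _ _).trans ?_
  rw [detForm_apply]
  congr 1
  ext i : 1
  fin_cases i <;> rfl

/-- In coordinates, the fundamental form of `(φ, θ)` is a multiple of the one of a quadruple of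
alternating matrices. -/
theorem exists_fundForm_eq (φ : ⋀[R]^4 L ⊗[R] L →ₗ[R] ⋀[R]^2 M)
    (θ : ⋀[R]^5 M →ₗ[R] ⨂[R]^3 (⋀[R]^4 L)) (q : QuasiBasis R L 4 f) (m : QuasiBasis R M 5 f) :
    ∃ (A : Matrix (Fin 4) (Fin 10) R) (t : R), ∀ ξ η ζ : Fin 4 → R,
      f ^ 34 • fundForm φ θ q.vol q.vol q.vol (q.comb ξ) (q.comb η) (q.comb ζ) =
        (t * quadForm A ξ η ζ) • detForm q.vol q.vol q.vol q.vol := by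
  choose a ha using fun i => m.exists_bivector (φ (q.vol ⊗ₜ q.vec i))
  obtain ⟨t, ht⟩ := q.exists_tprod_eq (θ m.vol)
  have hφ (ξ : Fin 4 → R) :
      f ^ 2 • φ (q.vol ⊗ₜ q.comb ξ) = bivector m.vec (Matrix.vecMul ξ (Matrix.of a)) := by
    rw [bivector_vecMul, q.comb_apply, TensorProduct.tmul_sum, map_sum, Finset.smul_sum]
    refine Finset.sum_congr rfl fun i _ => ?_
    rw [TensorProduct.tmul_smul, map_smul, smul_comm, ha]
    rfl
  -- Each copy of `θ m.vol` lies in a threefold tensor power of `Λ⁴ L` and costs `(f ^ 4) ^ 3`;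
  -- there are two copies.
  have hθ : f ^ 24 • thetaSq θ (m.vol ⊗ₜ m.vol) =
      t ^ 2 • detForm q.vol q.vol q.vol q.vol := by
    rw [← mulEquiv_tprod_const, thetaSq_tmul, ← map_smul, ← map_smul, pow_two,
      ← TensorProduct.smul_tmul_smul, ← ht, TensorProduct.smul_tmul_smul]
    congr 2
    ring
  refine ⟨Matrix.of a, t ^ 2, fun ξ η ζ => ?_⟩
  have hc := contract_smul (f ^ 2) ((f ^ 2) ^ 2) ((f ^ 2) ^ 2) (φ (q.vol ⊗ₜ q.comb ξ))
    (box (φ (q.vol ⊗ₜ q.comb η))) (box (φ (q.vol ⊗ₜ q.comb ζ)))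
  rw [← box_smul, ← box_smul, hφ, hφ, hφ, contract_bivector] at hc
  -- The bivectors cost `f ^ 2` each, and the contraction has degrees 1, 2 and 2 in them, which adds
  -- `f ^ 10` to `f ^ 24`.
  have hpow : f ^ 34 = f ^ 24 * (f ^ 2 * (f ^ 2) ^ 2 * (f ^ 2) ^ 2) := by ring
  rw [hpow, mul_smul, fundForm, ← map_smul, ← hc, map_smul, smul_comm]
  rw [mul_comm, mul_smul, ← hθ]
  rfl

theorem wedgeLast_smul (r₁ r₂ r₃ : R) (x y z w : L) :
    wedgeLast (R := R) (r₁ • x) (r₂ • y) (r₃ • z) w = (r₁ * r₂ * r₃) • wedgeLast x y z w := by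
  apply Subtype.ext
  rw [Submodule.coe_smul, wedgeLast_apply, wedgeLast_apply]
  simp [wedge₄, ExteriorAlgebra.ιMulti_apply, smul_smul, mul_left_comm, mul_comm]

theorem QuasiBasis.wedgeLast_comb (q : QuasiBasis R L 4 f) (ξ η ζ ν : Fin 4 → R) :
    wedgeLast (q.comb ξ) (q.comb η) (q.comb ζ) (q.comb ν) = det4 ξ η ζ ν • q.vol := by
  rw [wedgeLast_apply, ← det_eq_det4, ← q.ιMulti_comb]
  change exteriorPower.ιMulti R 4 _ = _
  congr 1
  ext i
  fin_cases i <;> rfl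

theorem QuasiBasis.det_wedgeLast (q : QuasiBasis R L 4 f) (x y z w : L) :
    q.det (wedgeLast x y z w) = det4 (q.coord x) (q.coord y) (q.coord z) (q.coord w) := by
  rw [wedgeLast_apply, wedge₄, q.det_ιMulti, ← det_eq_det4]
  congr 1
  ext i j
  fin_cases i <;> rfl

theorem QuasiBasis.detTensor_detForm (q : QuasiBasis R L 4 f) (w : ⋀[R]^4 L) :
    q.detTensor 6 (detForm q.vol q.vol q.vol w) = f ^ 20 * q.det w := by
  rw [detForm_apply, q.detTensor_tprod]
  simp [Fin.prod_univ_succ, q.det_vol]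
  ring

/-- The form has degrees 1, 2, 2 in the three pairs `(lᵢ, x)`, `(l₂, y)`, `(l₃, z)` read in order.
Each degree costs `f ^ 4` for the volume and `f` for the vector, so the exponent is `5 * 5`. -/
theorem QuasiBasis.smul_fundForm (q : QuasiBasis R L 4 f)
    (φ : ⋀[R]^4 L ⊗[R] L →ₗ[R] ⋀[R]^2 M) (θ : ⋀[R]^5 M →ₗ[R] ⨂[R]^3 (⋀[R]^4 L))
    (l₁ l₂ l₃ : ⋀[R]^4 L) (x y z : L) :
    f ^ 25 • fundForm φ θ l₁ l₂ l₃ x y z = (q.det l₁ * q.det l₂ ^ 2 * q.det l₃ ^ 2) •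
      fundForm φ θ q.vol q.vol q.vol (q.comb (q.coord x)) (q.comb (q.coord y))
        (q.comb (q.coord z)) := by
  have h1 := fundForm_smul φ θ (f ^ 4) (f ^ 4) (f ^ 4) f f f l₁ l₂ l₃ x y z
  have h2 := fundForm_smul φ θ (q.det l₁) (q.det l₂) (q.det l₃) 1 1 1 q.vol q.vol q.vol
    (f • x) (f • y) (f • z)
  simp only [one_smul, mul_one] at h2
  rw [q.comb_coord, q.comb_coord, q.comb_coord, ← h2, ← q.smul_eq_det_smul_vol,
    ← q.smul_eq_det_smul_vol, ← q.smul_eq_det_smul_vol, h1]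
  congr 1
  ring

/-- Five volume factors cost `f ^ 20` and the vectors `x, y, z` one `f` each; `w` is left untouched.
-/
theorem QuasiBasis.smul_detForm (q : QuasiBasis R L 4 f) (l₁ l₂ l₃ : ⋀[R]^4 L) (x y z w : L) :
    f ^ 23 • detForm l₁ l₂ l₃ (wedgeLast x y z w) = (q.det l₁ * q.det l₂ ^ 2 * q.det l₃ ^ 2) •
      detForm q.vol q.vol q.vol (wedgeLast (q.comb (q.coord x)) (q.comb (q.coord y))
        (q.comb (q.coord z)) w) := by
  rw [← detForm_smul, ← q.smul_eq_det_smul_vol, ← q.smul_eq_det_smul_vol,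
    ← q.smul_eq_det_smul_vol, q.comb_coord, q.comb_coord, q.comb_coord, wedgeLast_smul, map_smul,
    detForm_smul, smul_smul]
  congr 1
  ring

/-- A product on `L` with the fundamental form of `(φ, θ)` exists locally. -/
theorem exists_hasForm (φ : ⋀[R]^4 L ⊗[R] L →ₗ[R] ⋀[R]^2 M)
    (θ : ⋀[R]^5 M →ₗ[R] ⨂[R]^3 (⋀[R]^4 L)) (q : QuasiBasis R L 4 f) (m : QuasiBasis R M 5 f) :
    ∃ β : L →ₗ[R] L →ₗ[R] L, (∀ x y, β x y = β y x) ∧ HasForm φ θ (f ^ 59) β := by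
  obtain ⟨A, t, hA⟩ := exists_fundForm_eq φ θ q m
  -- The coordinate product is transported to `L`. The factor `f ^ 23` is the one that
  -- `smul_detForm` consumes, while `59 = 34 + 25` is the cost on the side of `fundForm`.
  refine ⟨(f ^ 23 * t) • ((quadMul A).compl₁₂ q.coord q.coord).compr₂ q.comb, fun x y => ?_,
    fun l₁ l₂ l₃ x y z => ?_⟩
  · simp only [LinearMap.smul_apply, LinearMap.compr₂_apply, LinearMap.compl₁₂_apply]
    rw [(quadIdentities A 0 _ _).comm]
  · have hpow : f ^ 59 = f ^ 34 * f ^ 25 := by ring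
    rw [hpow, mul_smul, q.smul_fundForm, smul_comm, hA]
    simp only [LinearMap.smul_apply, LinearMap.compr₂_apply, LinearMap.compl₁₂_apply]
    rw [mul_smul (f ^ 23), map_smul, map_smul, q.smul_detForm, map_smul (wedgeLast _ _ _),
      map_smul, q.wedgeLast_comb, map_smul, (quadIdentities A _ _ _).det, smul_smul t]

/-- The product in coordinates of a product on `L` with the fundamental form of `(φ, θ)`. -/
theorem HasForm.exists_quadForm [IsDomain R] (hf : f ≠ 0) (φ : ⋀[R]^4 L ⊗[R] L →ₗ[R] ⋀[R]^2 M)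
    (θ : ⋀[R]^5 M →ₗ[R] ⨂[R]^3 (⋀[R]^4 L)) (q : QuasiBasis R L 4 f) (m : QuasiBasis R M 5 f) :
    ∃ (A : Matrix (Fin 4) (Fin 10) R) (t : R), ∀ (r : R) (β : L →ₗ[R] L →ₗ[R] L),
      HasForm φ θ r β → ∀ ξ η ζ : Fin 4 → R,
        det4 ξ η ζ (f ^ 33 • q.coord (β (q.comb η) (q.comb ζ))) = r * (t * quadForm A ξ η ζ) := by
  obtain ⟨A, t, hA⟩ := exists_fundForm_eq φ θ q m
  refine ⟨A, t, fun r β hβ ξ η ζ => ?_⟩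
  have h := congrArg (q.detTensor 6) (congrArg (r • ·) (hA ξ η ζ))
  simp only [smul_comm r] at h
  rw [hβ, map_smul, map_smul, map_smul, q.detTensor_detForm, q.detTensor_detForm, q.det_vol,
    q.det_wedgeLast, q.coord_comb, q.coord_comb, q.coord_comb] at h
  simp only [smul_eq_mul] at h
  -- Taking determinants of all six factors leaves `f ^ (34 + 20 + 3)` on the left, where the 3
  -- comes from `ξ, η, ζ`, and `f ^ (20 + 4)` on the right; cancelling `f ^ 24` leaves `f ^ 33`.
  refine mul_left_cancel₀ (pow_ne_zero 24 hf) ?_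
  simp only [det4, Pi.smul_apply, smul_eq_mul] at h ⊢
  linear_combination h

end LocalForm

/-! ### Gluing -/

section Gluing

variable {R : Type*} [CommRing R] {L : Type*} [AddCommGroup L] [Module R L]
  {M : Type*} [AddCommGroup M] [Module R M]

/-- A scalar that maps a module of rank at least two into a submodule of rank one vanishes. -/
theorem QuasiBasis.eq_zero_of_forall_smul_eq [IsDomain R] {f : R} (hf : f ≠ 0)
    (q : QuasiBasis R L 4 f) (s : R) (z : L) (h : ∀ w : L, ∃ t : R, s • w = t • z) : s = 0 := by
  by_contra hs
  have hsf : s * f ≠ 0 := mul_ne_zero hs hf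
  obtain ⟨t₀, h₀⟩ := h (q.vec 0)
  obtain ⟨t₁, h₁⟩ := h (q.vec 1)
  have h₀' := congrArg q.coord h₀
  have h₁' := congrArg q.coord h₁
  simp only [map_smul, q.coord_vec] at h₀' h₁'
  have h00 := congrFun h₀' 0
  have h01 := congrFun h₀' 1
  have h10 := congrFun h₁' 0
  have h11 := congrFun h₁' 1
  simp at h00 h01 h10 h11
  -- If `s e₀ = t₀ z` and `s e₁ = t₁ z`, then `t₀ z₁ = 0`. Either `t₀ = 0` or `z₁ = 0`, and
  -- correspondingly `s f = t₀ z₀` or `s f = t₁ z₁` vanishes.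
  rcases h01 with h01 | h01
  · rw [h01, zero_mul] at h00
    simp [hs, hf] at h00
  · rw [h01, mul_zero] at h11
    simp [hs, hf] at h11

theorem IsLatticeOfRank.exists_quasiBasis_ne_zero [IsDedekindDomain R] {n : ℕ}
    (hL : IsLatticeOfRank R L n) : ∃ f : R, f ≠ 0 ∧ Nonempty (QuasiBasis R L n f) := by
  obtain ⟨p, hp⟩ := Ideal.exists_maximal R
  obtain ⟨f, hf, hq⟩ := hL.exists_quasiBasis p
  exact ⟨f, fun h => hf (h ▸ p.zero_mem), hq⟩

theorem exists_quasiBasis_pair [IsDedekindDomain R] (hL : IsLatticeOfRank R L 4)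
    (hM : IsLatticeOfRank R M 5) (p : Ideal R) [hp : p.IsMaximal] :
    ∃ f ∉ p, Nonempty (QuasiBasis R L 4 f) ∧ Nonempty (QuasiBasis R M 5 f) := by
  obtain ⟨f, hf, ⟨q⟩⟩ := hL.exists_quasiBasis p
  obtain ⟨g, hg, ⟨m⟩⟩ := hM.exists_quasiBasis p
  exact ⟨g * f, fun h => (hp.isPrime.mem_or_mem h).elim hg hf, ⟨q.scale g⟩,
    ⟨mul_comm f g ▸ m.scale f⟩⟩

theorem pow_notMem (p : Ideal R) [hp : p.IsMaximal] {f : R} (hf : f ∉ p) (n : ℕ) : f ^ n ∉ p :=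
  fun h => hf (hp.isPrime.mem_of_pow_mem n h)

/-- A product on `L` with the fundamental form of `(φ, θ)` exists. -/
theorem exists_hasForm_one [IsDedekindDomain R] (hL : IsLatticeOfRank R L 4)
    (hM : IsLatticeOfRank R M 5) (φ : ⋀[R]^4 L ⊗[R] L →ₗ[R] ⋀[R]^2 M)
    (θ : ⋀[R]^5 M →ₗ[R] ⨂[R]^3 (⋀[R]^4 L)) :
    ∃ β : L →ₗ[R] L →ₗ[R] L, (∀ x y, β x y = β y x) ∧ HasForm φ θ 1 β := by
  -- The ideal of denominators takes the place of gluing by a partition of unity: a local solution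
  -- cleared of denominators is already a product on all of `L`.
  let I : Ideal R :=
    { carrier := {r | ∃ β : L →ₗ[R] L →ₗ[R] L, (∀ x y, β x y = β y x) ∧ HasForm φ θ r β}
      add_mem' := by
        rintro r s ⟨β, hβ, hβ'⟩ ⟨γ, hγ, hγ'⟩
        exact ⟨β + γ, fun x y => by simp [hβ x y, hγ x y], hβ'.add hγ'⟩
      zero_mem' := ⟨0, fun _ _ => rfl, fun l₁ l₂ l₃ x y z => by simp⟩
      smul_mem' := by
        rintro s r ⟨β, hβ, hβ'⟩
        exact ⟨s • β, fun x y => by simp [hβ x y], hβ'.smul s⟩ }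
  have hI : I = ⊤ := ideal_eq_top_of_forall_exists_notMem I fun p hp => by
    obtain ⟨f, hf, ⟨q⟩, ⟨m⟩⟩ := exists_quasiBasis_pair hL hM p
    exact ⟨f ^ 59, pow_notMem p hf 59, exists_hasForm φ θ q m⟩
  exact (Ideal.eq_top_iff_one I).mp hI

variable {f : R}

/-- The product in coordinates of a product on `L`. -/
def QuasiBasis.coordMul (q : QuasiBasis R L 4 f) (β : L →ₗ[R] L →ₗ[R] L) :
    (Fin 4 → R) →ₗ[R] (Fin 4 → R) →ₗ[R] (Fin 4 → R) :=
  f ^ 33 • (β.compl₁₂ q.comb q.comb).compr₂ q.coord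

theorem QuasiBasis.coordMul_apply (q : QuasiBasis R L 4 f) (β : L →ₗ[R] L →ₗ[R] L)
    (ξ η : Fin 4 → R) : q.coordMul β ξ η = f ^ 33 • q.coord (β (q.comb ξ) (q.comb η)) := rfl

theorem QuasiBasis.coordMul_coord (q : QuasiBasis R L 4 f) (β : L →ₗ[R] L →ₗ[R] L) (x y : L) :
    q.coordMul β (q.coord x) (q.coord y) = q.coord (f ^ 35 • β x y) := by
  rw [q.coordMul_apply, q.comb_coord, q.comb_coord, ← map_smul]
  simp only [map_smul, LinearMap.smul_apply, smul_smul]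
  congr 1
  ring

/-- A commutative product with zero fundamental form comes from a change of lifts. -/
theorem HasForm.exists_eq_of_zero [IsDedekindDomain R] (hL : IsLatticeOfRank R L 4)
    (hM : IsLatticeOfRank R M 5) {φ : ⋀[R]^4 L ⊗[R] L →ₗ[R] ⋀[R]^2 M}
    {θ : ⋀[R]^5 M →ₗ[R] ⨂[R]^3 (⋀[R]^4 L)} {δ : L →ₗ[R] L →ₗ[R] L}
    (hδ : HasForm φ θ 0 δ) (hcomm : ∀ x y, δ x y = δ y x) :
    ∃ t : L →ₗ[R] R, ∀ y z, δ y z = t y • z + t z • y := by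
  let I : Ideal R :=
    { carrier := {r | ∃ t : L →ₗ[R] R, ∀ y z, r • δ y z = t y • z + t z • y}
      add_mem' := by
        rintro r s ⟨t, ht⟩ ⟨u, hu⟩
        refine ⟨t + u, fun y z => ?_⟩
        rw [add_smul, ht, hu, LinearMap.add_apply, LinearMap.add_apply]
        module
      zero_mem' := ⟨0, fun _ _ => by simp⟩
      smul_mem' := by
        rintro s r ⟨t, ht⟩
        refine ⟨s • t, fun y z => ?_⟩
        rw [smul_assoc, ht, LinearMap.smul_apply, LinearMap.smul_apply]
        module }
  have hI : I = ⊤ := ideal_eq_top_of_forall_exists_notMem I fun p hp => by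
    obtain ⟨f, hf, ⟨q⟩, ⟨m⟩⟩ := exists_quasiBasis_pair hL hM p
    have hf0 : f ≠ 0 := fun h => hf (h ▸ p.zero_mem)
    obtain ⟨A, t, hA⟩ := HasForm.exists_quadForm hf0 φ θ q m
    obtain ⟨τ, hτ⟩ := exists_eq_mulOfConst_add (q.coordMul δ)
      (fun ξ η => by rw [q.coordMul_apply, q.coordMul_apply, hcomm]) (fun _ _ _ => 0)
      (fun ξ η ζ => (hA 0 δ hδ ξ η ζ).trans (zero_mul _))
    -- The exponent is 33 from `coordMul`, 2 from its two arguments and 1 from returning to `L`;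
    -- this last `f` also appears in front of the linear form.
    refine ⟨f ^ 36, pow_notMem p hf 36, f • τ ∘ₗ q.coord, fun y z => ?_⟩
    have h := congrArg q.comb (hτ (q.coord y) (q.coord z))
    rw [q.coordMul_coord, structConst_zero, mulOfConst_zero, q.comb_coord, map_add, map_add,
      map_smul, map_smul, q.comb_coord, q.comb_coord] at h
    simp only [LinearMap.zero_apply, map_zero, zero_add] at h
    rw [pow_succ', mul_smul, h]
    simp only [LinearMap.smul_apply, LinearMap.comp_apply, smul_eq_mul]
    module
  obtain ⟨t, ht⟩ := (Ideal.eq_top_iff_one I).mp hI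
  exact ⟨t, fun y z => by rw [← ht, one_smul]⟩

/-- A commutative product on `L` with the fundamental form of `(φ, θ)` extends to a product that is
associative up to scalars. -/
theorem HasForm.exists_assoc [IsDedekindDomain R] (hL : IsLatticeOfRank R L 4)
    (hM : IsLatticeOfRank R M 5) {φ : ⋀[R]^4 L ⊗[R] L →ₗ[R] ⋀[R]^2 M}
    {θ : ⋀[R]^5 M →ₗ[R] ⨂[R]^3 (⋀[R]^4 L)} {β : L →ₗ[R] L →ₗ[R] L}
    (hβ : HasForm φ θ 1 β) (hcomm : ∀ x y, β x y = β y x) :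
    ∃ B : L →ₗ[R] L →ₗ[R] R, ∀ x y z,
      β (β x y) z - β x (β y z) = B y z • x - B x y • z := by
  let I : Ideal R :=
    { carrier := {r | ∃ B : L →ₗ[R] L →ₗ[R] R, ∀ x y z,
        r • (β (β x y) z - β x (β y z)) = B y z • x - B x y • z}
      add_mem' := by
        rintro r s ⟨B, hB⟩ ⟨C, hC⟩
        refine ⟨B + C, fun x y z => ?_⟩
        rw [add_smul, hB, hC]
        simp only [LinearMap.add_apply]
        module
      zero_mem' := ⟨0, fun _ _ _ => by simp⟩
      smul_mem' := by
        rintro s r ⟨B, hB⟩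
        refine ⟨s • B, fun x y z => ?_⟩
        rw [smul_assoc, hB]
        simp only [LinearMap.smul_apply]
        module }
  have hI : I = ⊤ := ideal_eq_top_of_forall_exists_notMem I fun p hp => by
    obtain ⟨f, hf, ⟨q⟩, ⟨m⟩⟩ := exists_quasiBasis_pair hL hM p
    have hf0 : f ≠ 0 := fun h => hf (h ▸ p.zero_mem)
    obtain ⟨A, t, hA⟩ := HasForm.exists_quadForm hf0 φ θ q m
    obtain ⟨τ, hτ⟩ := exists_eq_mulOfConst_add (q.coordMul β)
      (fun ξ η => by rw [q.coordMul_apply, q.coordMul_apply, hcomm])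
      (fun ξ η ζ => t * quadForm A ξ η ζ)
      (fun ξ η ζ => (hA 1 β hβ ξ η ζ).trans (one_mul _))
    rw [structConst_smul, mulOfConst_smul] at hτ
    -- Locally `β` is a change of lifts of `t • quadMul A`. Associators are quadratic in the
    -- product, so the scalar form of the latter is `t ^ 2 • quadScalar A`.
    have hassoc := assoc_change_lift (t • quadMul A) (q.coordMul β) (t ^ 2 • quadScalar A) τ
      (fun ξ η ζ => by
        simp only [LinearMap.smul_apply, map_smul, smul_smul, ← smul_sub, smul_eq_mul]
        rw [(quadIdentities A ξ η ζ).assoc]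
        module) hτ
    let C : (Fin 4 → R) →ₗ[R] (Fin 4 → R) →ₗ[R] R :=
      t ^ 2 • quadScalar A - (t • quadMul A).compr₂ τ - (LinearMap.mul R R).compl₁₂ τ τ
    have hC ξ η : C ξ η = (t ^ 2 • quadScalar A) ξ η - τ ((t • quadMul A) ξ η) - τ ξ * τ η := rfl
    -- Each of the two nested products costs `f ^ 35`, and the return to `L` one more `f`.
    refine ⟨f ^ 71, pow_notMem p hf 71, f • C.compl₁₂ q.coord q.coord, fun x y z => ?_⟩
    have h := congrArg q.comb (hassoc (q.coord x) (q.coord y) (q.coord z))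
    rw [q.coordMul_coord, q.coordMul_coord, q.coordMul_coord, q.coordMul_coord, ← hC, ← hC] at h
    simp only [map_sub, map_smul, q.comb_coord, LinearMap.smul_apply, smul_smul] at h
    simp only [LinearMap.smul_apply, LinearMap.compl₁₂_apply, smul_eq_mul]
    rw [mul_comm f, mul_comm f, ← h]
    module
  obtain ⟨B, hB⟩ := (Ideal.eq_top_iff_one I).mp hI
  exact ⟨B, fun x y z => by rw [← hB, one_smul]⟩

end Gluing

/-! ### Rings on `R × L` -/

section ScalarPart

variable {R : Type*} [CommRing R] [IsDomain R] {L : Type*} [AddCommGroup L] [Module R L] {f : R}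

/-- The scalar part of an associative product is determined by its other part. -/
theorem QuasiBasis.scalarPart_unique (hf : f ≠ 0) (q : QuasiBasis R L 4 f)
    {B C : L →ₗ[R] L →ₗ[R] R}
    (h : ∀ x y z, B y z • x - B x y • z = C y z • x - C x y • z) : B = C := by
  refine LinearMap.ext₂ fun y z => sub_eq_zero.mp ?_
  refine q.eq_zero_of_forall_smul_eq hf _ z fun x => ⟨B x y - C x y, ?_⟩
  linear_combination (norm := module) h x y z

/-- By commutativity the associators of `(x, y, z)` and `(z, y, x)` cancel. Adding the two
identities makes `(B y z - B z y) • x` a multiple of `z` for every `x`, which is impossible in rank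
at least two unless the scalar vanishes. -/
theorem QuasiBasis.scalarPart_comm (hf : f ≠ 0) (q : QuasiBasis R L 4 f)
    {β : L →ₗ[R] L →ₗ[R] L} {B : L →ₗ[R] L →ₗ[R] R} (hcomm : ∀ x y, β x y = β y x)
    (h : ∀ x y z, β (β x y) z - β x (β y z) = B y z • x - B x y • z) (y z : L) :
    B y z = B z y := by
  refine sub_eq_zero.mp (q.eq_zero_of_forall_smul_eq hf _ z fun x => ⟨B x y - B y x, ?_⟩)
  have h₁ := h x y z
  have h₂ := h z y x
  rw [hcomm (β z y) x, hcomm z y, hcomm y x, hcomm z] at h₂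
  linear_combination (norm := module) -h₁ - h₂

/-- If a product is associative up to scalars, then the scalars satisfy the remaining identity that
associativity requires. -/
theorem QuasiBasis.scalarPart_assoc (hf : f ≠ 0) (q : QuasiBasis R L 4 f)
    {β : L →ₗ[R] L →ₗ[R] L} {B : L →ₗ[R] L →ₗ[R] R}
    (h : ∀ x y z, β (β x y) z - β x (β y z) = B y z • x - B x y • z) (x y z : L) :
    B (β x y) z = B x (β y z) := by
  refine sub_eq_zero.mp (q.eq_zero_of_forall_smul_eq hf _ z fun w =>
    ⟨B w (β x y) - B (β w x) y, ?_⟩)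
  -- The pentagon relation among the five bracketings of `w x y z`: the alternating sum of these
  -- associators cancels, leaving `B (β x y) z - B x (β y z)` times `w` equal to a multiple of `z`.
  have h₁ := h (β w x) y z
  have h₂ := h w (β x y) z
  have h₃ := h w x (β y z)
  have h₄ := congrArg (fun u => β u z) (h w x y)
  have h₅ := congrArg (β w) (h x y z)
  simp only [map_sub, map_smul, LinearMap.sub_apply, LinearMap.smul_apply] at h₄ h₅
  linear_combination (norm := module) h₁ - h₂ + h₃ - h₄ - h₅

end ScalarPart

/-- The data of a commutative and associative product on `R × L` with unit `(1, 0)`: the product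
of `(0, x)` and `(0, y)` is `(scalar x y, prod x y)`. -/
structure UnitalProduct (R : Type u) (L : Type v) [CommRing R] [AddCommGroup L] [Module R L] where
  /-- the component in `L` of the product -/
  prod : L →ₗ[R] L →ₗ[R] L
  /-- the component in `R` of the product -/
  scalar : L →ₗ[R] L →ₗ[R] R
  prod_comm : ∀ x y, prod x y = prod y x
  scalar_comm : ∀ x y, scalar x y = scalar y x
  prod_assoc : ∀ x y z, prod (prod x y) z - prod x (prod y z) = scalar y z • x - scalar x y • z
  scalar_assoc : ∀ x y z, scalar (prod x y) z = scalar x (prod y z)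

namespace UnitalProduct

variable {R : Type u} {L : Type v} [CommRing R] [AddCommGroup L] [Module R L]

/-- The module `R × L` with the multiplication given by `P`. -/
def Ring (_P : UnitalProduct R L) : Type (max u v) := R × L

variable (P : UnitalProduct R L)

instance : AddCommGroup P.Ring := inferInstanceAs (AddCommGroup (R × L))

instance : Module R P.Ring := inferInstanceAs (Module R (R × L))

instance : Mul P.Ring :=
  ⟨fun p q => (p.1 * q.1 + P.scalar p.2 q.2, p.1 • q.2 + q.1 • p.2 + P.prod p.2 q.2)⟩

instance : One P.Ring := ⟨(1, 0)⟩

variable {P}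

@[ext]
theorem Ring.ext {p q : P.Ring} (h₁ : p.1 = q.1) (h₂ : p.2 = q.2) : p = q := Prod.ext h₁ h₂

theorem fst_mul (p q : P.Ring) : (p * q).1 = p.1 * q.1 + P.scalar p.2 q.2 := rfl

theorem snd_mul (p q : P.Ring) : (p * q).2 = p.1 • q.2 + q.1 • p.2 + P.prod p.2 q.2 := rfl

theorem fst_one : (1 : P.Ring).1 = 1 := rfl

theorem snd_one : (1 : P.Ring).2 = 0 := rfl

theorem fst_zero : (0 : P.Ring).1 = 0 := rfl

theorem snd_zero : (0 : P.Ring).2 = 0 := rfl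

theorem fst_add (p q : P.Ring) : (p + q).1 = p.1 + q.1 := rfl

theorem snd_add (p q : P.Ring) : (p + q).2 = p.2 + q.2 := rfl

theorem fst_smul (r : R) (q : P.Ring) : (r • q).1 = r * q.1 := rfl

theorem snd_smul (r : R) (q : P.Ring) : (r • q).2 = r • q.2 := rfl

theorem Ring.mul_comm (p q : P.Ring) : p * q = q * p := by
  ext
  · rw [fst_mul, fst_mul, P.scalar_comm, _root_.mul_comm]
  · rw [snd_mul, snd_mul, P.prod_comm, add_comm (p.1 • q.2)]

theorem Ring.add_mul (p q r : P.Ring) : (p + q) * r = p * r + q * r := by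
  ext
  · simp only [fst_mul, fst_add, snd_add, map_add, LinearMap.add_apply]
    ring
  · simp only [snd_mul, snd_add, fst_add, map_add, LinearMap.add_apply]
    module

theorem Ring.one_mul (p : P.Ring) : 1 * p = p := by
  ext
  · simp [fst_mul, fst_one, snd_one]
  · simp [snd_mul, fst_one, snd_one]

theorem Ring.zero_mul (p : P.Ring) : 0 * p = 0 := by
  ext
  · simp [fst_mul, fst_zero, snd_zero]
  · simp [snd_mul, fst_zero, snd_zero]

theorem Ring.mul_assoc (p q r : P.Ring) : p * q * r = p * (q * r) := by
  ext
  · simp only [fst_mul, snd_mul, map_add, map_smul, LinearMap.add_apply, LinearMap.smul_apply,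
      smul_eq_mul, P.scalar_assoc]
    ring
  · have h := P.prod_assoc p.2 q.2 r.2
    simp only [fst_mul, snd_mul, map_add, map_smul, LinearMap.add_apply, LinearMap.smul_apply]
    linear_combination (norm := module) h

instance : CommRing P.Ring where
  mul_assoc := Ring.mul_assoc
  mul_comm := Ring.mul_comm
  one_mul := Ring.one_mul
  mul_one p := (Ring.mul_comm p 1).trans p.one_mul
  zero_mul := Ring.zero_mul
  mul_zero p := (Ring.mul_comm p 0).trans p.zero_mul
  right_distrib := Ring.add_mul
  left_distrib p q r := by
    rw [Ring.mul_comm, Ring.add_mul, Ring.mul_comm q, Ring.mul_comm r]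
  neg_add_cancel := neg_add_cancel
  zsmul := (· • ·)
  zsmul_zero' := SubNegMonoid.zsmul_zero'
  zsmul_succ' := SubNegMonoid.zsmul_succ'
  zsmul_neg' := SubNegMonoid.zsmul_neg'
  nsmul := (· • ·)
  nsmul_zero := AddMonoid.nsmul_zero
  nsmul_succ := AddMonoid.nsmul_succ
  sub_eq_add_neg := sub_eq_add_neg

theorem Ring.smul_mul (r : R) (p q : P.Ring) : r • p * q = r • (p * q) := by
  ext
  · simp only [fst_mul, fst_smul, snd_smul, map_smul, LinearMap.smul_apply, smul_eq_mul]
    ring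
  · simp only [snd_mul, fst_smul, snd_smul, map_smul, LinearMap.smul_apply]
    module

instance : Algebra R P.Ring :=
  Algebra.ofModule Ring.smul_mul fun r p q => by
    rw [Ring.mul_comm p, Ring.smul_mul, Ring.mul_comm q]

theorem algebraMap_eq (r : R) : algebraMap R P.Ring r = (r, 0) := by
  rw [Algebra.algebraMap_eq_smul_one]
  ext
  · exact mul_one r
  · exact smul_zero r

variable (P)

/-- The projection to `L`. -/
def Ring.snd : P.Ring →ₗ[R] L := LinearMap.snd R R L

theorem Ring.ker_snd : LinearMap.ker (Ring.snd P) = LinearMap.range (Algebra.linearMap R P.Ring) := by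
  ext p
  constructor
  · intro h
    refine ⟨p.1, ?_⟩
    rw [Algebra.linearMap_apply, algebraMap_eq]
    exact Ring.ext rfl (LinearMap.mem_ker.mp h).symm
  · rintro ⟨r, rfl⟩
    rw [Algebra.linearMap_apply, algebraMap_eq]
    rfl

/-- The identification of `P.Ring / R` with `L`. -/
def modBaseEquiv : ModBase R P.Ring ≃ₗ[R] L :=
  Submodule.quotEquivOfEq _ _ (Ring.ker_snd P).symm ≪≫ₗ
    (Ring.snd P).quotKerEquivOfSurjective fun x => ⟨(0, x), rfl⟩

theorem modBaseEquiv_mk (p : P.Ring) : P.modBaseEquiv (Submodule.Quotient.mk p) = p.2 := rfl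

theorem isQuinticRing [IsDomain R] (hL : IsLatticeOfRank R L 4) : IsQuinticRing R P.Ring := by
  have := hL.finite
  have := hL.torsionFree
  have : Module.Finite R P.Ring := inferInstanceAs (Module.Finite R (R × L))
  refine ⟨this, inferInstanceAs (Module.IsTorsionFree R (R × L)), ?_⟩
  have hinj : Function.Injective (Algebra.linearMap R P.Ring) := fun r s h => by
    rw [Algebra.linearMap_apply, Algebra.linearMap_apply, algebraMap_eq, algebraMap_eq] at h
    exact congrArg Prod.fst h
  have h := Submodule.finrank_quotient_add_finrank (LinearMap.range (Algebra.linearMap R P.Ring))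
  rw [P.modBaseEquiv.finrank_eq, hL.finrank_eq, LinearMap.finrank_range_of_inj hinj,
    Module.finrank_self] at h
  exact h.symm

/-- Changing the lifts of `y` and `z` alters the image of `yz` only by multiples of `y` and `z`,
which die in `x ∧ y ∧ z ∧ yz`. -/
theorem isResolvent {M : Type*} [AddCommGroup M] [Module R M] (hM : IsLatticeOfRank R M 5)
    {φ : ⋀[R]^4 L ⊗[R] L →ₗ[R] ⋀[R]^2 M} {θ : ⋀[R]^5 M →ₗ[R] ⨂[R]^3 (⋀[R]^4 L)}
    (h : HasForm φ θ 1 P.prod) : IsResolvent P.modBaseEquiv φ θ := by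
  refine ⟨hM, fun l₁ l₂ l₃ x y z y' z' hy hz => ?_⟩
  rw [modBaseEquiv_mk] at hy hz
  have h' := h l₁ l₂ l₃ x y z
  rw [one_smul, detForm_apply] at h'
  refine h'.trans ?_
  have hyy : wedgeLast (R := R) x y z y = 0 := by
    rw [wedgeLast_apply]
    exact (exteriorPower.ιMulti R 4 (M := L)).map_eq_zero_of_eq ![x, y, z, y] (i := 1) (j := 3) rfl
      (by decide)
  have hzz : wedgeLast (R := R) x y z z = 0 := by
    rw [wedgeLast_apply]
    exact (exteriorPower.ιMulti R 4 (M := L)).map_eq_zero_of_eq ![x, y, z, z] (i := 2) (j := 3) rfl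
      (by decide)
  have hw : wedgeLast (R := R) x y z (P.modBaseEquiv (Submodule.Quotient.mk (y' * z'))) =
      wedgeLast (R := R) x y z (P.prod y z) := by
    rw [modBaseEquiv_mk, snd_mul, hy, hz, map_add, map_add, map_smul, map_smul, hyy, hzz,
      smul_zero, smul_zero, zero_add, zero_add]
  rw [← hw, wedgeLast_apply]

end UnitalProduct

/-! ### Existence and uniqueness -/

section Splitting

variable {R : Type*} [CommRing R] {L : Type*} [AddCommGroup L] [Module R L]
  {Q : Type*} [CommRing Q] [Algebra R Q]

/-- The isomorphism `ψ : R × L → Q` is compatible with `R → Q` and with `Q → Q / R → L`. -/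
structure IsSplitting (e : ModBase R Q ≃ₗ[R] L) (ψ : (R × L) ≃ₗ[R] Q) : Prop where
  algebraMap_eq : ∀ r, ψ (r, 0) = algebraMap R Q r
  mk_eq : ∀ p, e (Submodule.Quotient.mk (ψ p)) = p.2

theorem IsQuinticRing.algebraMap_injective [IsDomain R] (hQ : IsQuinticRing R Q) :
    Function.Injective (algebraMap R Q) := by
  have := hQ.torsionFree
  have : Nontrivial Q := by
    refine not_subsingleton_iff_nontrivial.mp fun h => ?_
    have h5 := hQ.finrank_eq
    rw [Module.finrank_zero_of_subsingleton] at h5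
    exact absurd h5 (by decide)
  exact FaithfulSMul.algebraMap_injective R Q

/-- A linear section of `Q → L` defines a splitting. -/
theorem exists_isSplitting_of_section (hinj : Function.Injective (algebraMap R Q))
    (e : ModBase R Q ≃ₗ[R] L) (s : L →ₗ[R] Q) (hs : ∀ x, e (Submodule.Quotient.mk (s x)) = x) :
    ∃ ψ : (R × L) ≃ₗ[R] Q, IsSplitting e ψ ∧ ∀ r x, ψ (r, x) = algebraMap R Q r + s x := by
  have h0 r : (Submodule.Quotient.mk (algebraMap R Q r) : ModBase R Q) = 0 :=
    (Submodule.Quotient.mk_eq_zero _).mpr ⟨r, rfl⟩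
  have hmk (p : R × L) :
      e (Submodule.Quotient.mk ((Algebra.linearMap R Q).coprod s p)) = p.2 := by
    rw [LinearMap.coprod_apply, Algebra.linearMap_apply, Submodule.Quotient.mk_add, h0, zero_add, hs]
  have hbij : Function.Bijective ((Algebra.linearMap R Q).coprod s) := by
    constructor
    · refine (injective_iff_map_eq_zero _).mpr fun p hp => ?_
      have h2 : p.2 = 0 := by rw [← hmk, hp, Submodule.Quotient.mk_zero, map_zero]
      rw [LinearMap.coprod_apply, h2, map_zero, add_zero, Algebra.linearMap_apply,
        map_eq_zero_iff _ hinj] at hp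
      exact Prod.ext hp h2
    · intro x
      have hx : (Submodule.Quotient.mk (x - s (e (Submodule.Quotient.mk x))) : ModBase R Q) = 0 := by
        apply e.injective
        rw [Submodule.Quotient.mk_sub, map_sub, hs, sub_self, map_zero]
      obtain ⟨r, hr⟩ := (Submodule.Quotient.mk_eq_zero _).mp hx
      exact ⟨(r, e (Submodule.Quotient.mk x)), by rw [LinearMap.coprod_apply, hr, sub_add_cancel]⟩
  refine ⟨LinearEquiv.ofBijective _ hbij, ⟨fun r => ?_, hmk⟩, fun r x => rfl⟩
  rw [LinearEquiv.ofBijective_apply, LinearMap.coprod_apply, map_zero, add_zero]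
  rfl

/-- A finite torsion-free module over a Dedekind domain is projective, so `Q → L` has a linear
section. -/
theorem exists_isSplitting [IsDedekindDomain R] {n : ℕ} (hL : IsLatticeOfRank R L n)
    (hQ : IsQuinticRing R Q) (e : ModBase R Q ≃ₗ[R] L) : ∃ ψ, IsSplitting e ψ := by
  have := hL.finite
  have := hL.torsionFree
  have := Module.finitePresentation_of_finite R L
  have : Module.Projective R L := Module.Flat.projective_of_finitePresentation
  obtain ⟨s, hs⟩ := Module.projective_lifting_property
    (e.toLinearMap ∘ₗ (LinearMap.range (Algebra.linearMap R Q)).mkQ) LinearMap.id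
    (e.surjective.comp (Submodule.mkQ_surjective _))
  obtain ⟨ψ, hψ, -⟩ := exists_isSplitting_of_section hQ.algebraMap_injective e s
    fun x => LinearMap.congr_fun hs x
  exact ⟨ψ, hψ⟩

namespace IsSplitting

variable {e : ModBase R Q ≃ₗ[R] L} {ψ : (R × L) ≃ₗ[R] Q}

theorem apply_eq (h : IsSplitting e ψ) (r : R) (x : L) :
    ψ (r, x) = algebraMap R Q r + ψ (0, x) := by
  rw [← h.algebraMap_eq, ← map_add, Prod.mk_add_mk, add_zero, zero_add]

theorem apply_mul (h : IsSplitting e ψ) (r s : R) (x y : L) {a : R} {z : L}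
    (hxy : ψ (0, x) * ψ (0, y) = ψ (a, z)) :
    ψ (r, x) * ψ (s, y) = ψ (r * s + a, r • y + s • x + z) := by
  have hr (c : R) (v : L) : algebraMap R Q c * ψ (0, v) = ψ (0, c • v) := by
    rw [← Algebra.smul_def, ← map_smul, Prod.smul_mk, smul_zero]
  have hsum : ψ (r * s + a, r • y + s • x + z) =
      algebraMap R Q (r * s) + ψ (0, r • y) + ψ (0, s • x) + ψ (a, z) := by
    rw [← h.algebraMap_eq, ← map_add, ← map_add, ← map_add]
    simp
  rw [hsum, h.apply_eq r, h.apply_eq s, map_mul, ← hr, ← hr, ← hxy]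
  ring

/-- Changing a splitting by a linear form. -/
theorem exists_change (h : IsSplitting e ψ) (hinj : Function.Injective (algebraMap R Q))
    (t : L →ₗ[R] R) : ∃ ψ', IsSplitting e ψ' ∧ ∀ x, ψ' (0, x) = ψ (t x, x) := by
  obtain ⟨ψ', hψ', happ⟩ := exists_isSplitting_of_section hinj e
    (ψ.toLinearMap ∘ₗ t.prod LinearMap.id) fun x => h.mk_eq (t x, x)
  exact ⟨ψ', hψ', fun x => by rw [happ, map_zero, zero_add]; rfl⟩

/-- The product on `L` with values in `R × L` defined by a splitting. -/
theorem exists_mul_eq (ψ : (R × L) ≃ₗ[R] Q) :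
    ∃ (β : L →ₗ[R] L →ₗ[R] L) (B : L →ₗ[R] L →ₗ[R] R), ∀ y z,
      ψ (0, y) * ψ (0, z) = ψ (B y z, β y z) := by
  let ι : L →ₗ[R] Q := ψ.toLinearMap ∘ₗ LinearMap.inr R R L
  let m : L →ₗ[R] L →ₗ[R] R × L := ((LinearMap.mul R Q).compl₁₂ ι ι).compr₂ ψ.symm.toLinearMap
  exact ⟨m.compr₂ (LinearMap.snd R R L), m.compr₂ (LinearMap.fst R R L),
    fun y z => (ψ.apply_symm_apply (ψ (0, y) * ψ (0, z))).symm⟩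

variable {β : L →ₗ[R] L →ₗ[R] L} {B : L →ₗ[R] L →ₗ[R] R}

theorem prod_comm (hmul : ∀ y z, ψ (0, y) * ψ (0, z) = ψ (B y z, β y z)) (y z : L) :
    β y z = β z y := by
  have h := hmul y z
  rw [mul_comm, hmul] at h
  exact (congrArg Prod.snd (ψ.injective h)).symm

theorem prod_assoc (h : IsSplitting e ψ)
    (hmul : ∀ y z, ψ (0, y) * ψ (0, z) = ψ (B y z, β y z)) (x y z : L) :
    β (β x y) z - β x (β y z) = B y z • x - B x y • z := by
  have h' := mul_assoc (ψ (0, x)) (ψ (0, y)) (ψ (0, z))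
  rw [hmul, hmul, h.apply_mul _ _ _ _ (hmul _ _), h.apply_mul _ _ _ _ (hmul _ _)] at h'
  have h₂ := congrArg Prod.snd (ψ.injective h')
  simp only [zero_smul, zero_add, add_zero] at h₂
  linear_combination (norm := module) h₂

theorem hasForm {M : Type*} [AddCommGroup M] [Module R M] (h : IsSplitting e ψ)
    (hmul : ∀ y z, ψ (0, y) * ψ (0, z) = ψ (B y z, β y z))
    {φ : ⋀[R]^4 L ⊗[R] L →ₗ[R] ⋀[R]^2 M} {θ : ⋀[R]^5 M →ₗ[R] ⨂[R]^3 (⋀[R]^4 L)}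
    (hres : IsResolvent e φ θ) : HasForm φ θ 1 β := by
  intro l₁ l₂ l₃ x y z
  have h' := hres.identity l₁ l₂ l₃ x y z _ _ (h.mk_eq (0, y)) (h.mk_eq (0, z))
  rw [hmul, h.mk_eq] at h'
  rw [one_smul, detForm_apply, wedgeLast_apply]
  exact h'

end IsSplitting

end Splitting

theorem exists_isResolvent {R : Type u} [CommRing R] [IsDedekindDomain R]
    {L : Type v} [AddCommGroup L] [Module R L] (hL : IsLatticeOfRank R L 4)
    {M : Type w} [AddCommGroup M] [Module R M] (hM : IsLatticeOfRank R M 5)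
    (φ : ⋀[R]^4 L ⊗[R] L →ₗ[R] ⋀[R]^2 M) (θ : ⋀[R]^5 M →ₗ[R] ⨂[R]^3 (⋀[R]^4 L)) :
    ∃ P : UnitalProduct R L, IsResolvent P.modBaseEquiv φ θ := by
  obtain ⟨β, hcomm, hβ⟩ := exists_hasForm_one hL hM φ θ
  obtain ⟨B, hB⟩ := hβ.exists_assoc hL hM hcomm
  obtain ⟨f, hf, ⟨q⟩⟩ := hL.exists_quasiBasis_ne_zero
  let P : UnitalProduct R L :=
    ⟨β, B, hcomm, q.scalarPart_comm hf hcomm hB, hB, q.scalarPart_assoc hf hB⟩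
  exact ⟨P, P.isResolvent hM hβ⟩

/-- After lifts are chosen, the two products on `L` have the same form and so differ by a change of
lifts. Adjusting the lifts in `Q₂` makes them equal, which forces the scalar parts to agree as well;
the identification through `R × L` is then multiplicative. -/
theorem exists_algEquiv {R : Type u} [CommRing R] [IsDedekindDomain R]
    {L : Type v} [AddCommGroup L] [Module R L] (hL : IsLatticeOfRank R L 4)
    {M : Type w} [AddCommGroup M] [Module R M] {φ : ⋀[R]^4 L ⊗[R] L →ₗ[R] ⋀[R]^2 M}
    {θ : ⋀[R]^5 M →ₗ[R] ⨂[R]^3 (⋀[R]^4 L)}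
    {Q₁ : Type s} [CommRing Q₁] [Algebra R Q₁] {e₁ : ModBase R Q₁ ≃ₗ[R] L}
    {Q₂ : Type t} [CommRing Q₂] [Algebra R Q₂] {e₂ : ModBase R Q₂ ≃ₗ[R] L}
    (hQ₁ : IsQuinticRing R Q₁) (hres₁ : IsResolvent e₁ φ θ)
    (hQ₂ : IsQuinticRing R Q₂) (hres₂ : IsResolvent e₂ φ θ) :
    ∃ f : Q₁ ≃ₐ[R] Q₂, ∀ q : Q₁,
      e₂ (Submodule.Quotient.mk (f q)) = e₁ (Submodule.Quotient.mk q) := by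
  obtain ⟨ψ₁, hψ₁⟩ := exists_isSplitting hL hQ₁ e₁
  obtain ⟨ψ, hψ⟩ := exists_isSplitting hL hQ₂ e₂
  obtain ⟨β₁, B₁, hmul₁⟩ := IsSplitting.exists_mul_eq ψ₁
  obtain ⟨β, B, hmul⟩ := IsSplitting.exists_mul_eq ψ
  -- The difference of the two products has form `1 - 1 = 0`, so it is given by a linear form `t`.
  have hδ := (hψ₁.hasForm hmul₁ hres₁).sub (hψ.hasForm hmul hres₂)
  rw [sub_self] at hδ
  obtain ⟨t, ht⟩ := hδ.exists_eq_of_zero hL hres₁.lattice fun x y => by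
    rw [LinearMap.sub_apply, LinearMap.sub_apply, LinearMap.sub_apply, LinearMap.sub_apply,
      IsSplitting.prod_comm hmul₁, IsSplitting.prod_comm hmul]
  obtain ⟨ψ₂, hψ₂, hψ₂t⟩ := hψ.exists_change hQ₂.algebraMap_injective t
  obtain ⟨β₂, B₂, hmul₂⟩ := IsSplitting.exists_mul_eq ψ₂
  have hβ : β₂ = β₁ := LinearMap.ext₂ fun y z => by
    have h₁ := congrArg (fun q => e₂ (Submodule.Quotient.mk q)) (hmul₂ y z)
    simp only [hψ₂.mk_eq] at h₁
    rw [← h₁, hψ₂t, hψ₂t, hψ.apply_mul _ _ _ _ (hmul _ _), hψ.mk_eq]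
    change t y • z + t z • y + β y z = β₁ y z
    rw [← ht, LinearMap.sub_apply, LinearMap.sub_apply, sub_add_cancel]
  subst hβ
  obtain ⟨f, hf, ⟨q⟩⟩ := hL.exists_quasiBasis_ne_zero
  -- Both scalar parts express the associator of the same product, which determines them.
  obtain rfl : B₂ = B₁ := q.scalarPart_unique hf fun x y z =>
    (hψ₂.prod_assoc hmul₂ x y z).symm.trans (hψ₁.prod_assoc hmul₁ x y z)
  refine ⟨AlgEquiv.ofLinearEquiv (ψ₁.symm ≪≫ₗ ψ₂) ?_ fun x y => ?_, fun x => ?_⟩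
  · rw [LinearEquiv.trans_apply, ← map_one (algebraMap R Q₁), ← hψ₁.algebraMap_eq,
      LinearEquiv.symm_apply_apply, hψ₂.algebraMap_eq, map_one]
  · obtain ⟨⟨r, x⟩, rfl⟩ := ψ₁.surjective x
    obtain ⟨⟨s, y⟩, rfl⟩ := ψ₁.surjective y
    rw [hψ₁.apply_mul _ _ _ _ (hmul₁ _ _)]
    simp only [LinearEquiv.trans_apply, LinearEquiv.symm_apply_apply]
    rw [hψ₂.apply_mul _ _ _ _ (hmul₂ _ _)]
  · obtain ⟨p, rfl⟩ := ψ₁.surjective x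
    rw [AlgEquiv.ofLinearEquiv_apply, LinearEquiv.trans_apply, LinearEquiv.symm_apply_apply,
      hψ₁.mk_eq, hψ₂.mk_eq]

end QuinticResolvent

end

theorem theorem1 (R : Type u) [CommRing R] [IsDedekindDomain R]
    (L : Type v) [AddCommGroup L] [Module R L] (hL : QuinticResolvent.IsLatticeOfRank R L 4)
    (M : Type w) [AddCommGroup M] [Module R M] (hM : QuinticResolvent.IsLatticeOfRank R M 5)
    (φ : ⋀[R]^4 L ⊗[R] L →ₗ[R] ⋀[R]^2 M)
    (θ : ⋀[R]^5 M →ₗ[R] ⨂[R]^3 (⋀[R]^4 L)) :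
    (∃ (Q : Type (max u v)) (_ : CommRing Q) (_ : Algebra R Q)
        (e : QuinticResolvent.ModBase R Q ≃ₗ[R] L),
        QuinticResolvent.IsQuinticRing R Q ∧ QuinticResolvent.IsResolvent e φ θ) ∧
    (∀ (Q₁ : Type s) [CommRing Q₁] [Algebra R Q₁] (e₁ : QuinticResolvent.ModBase R Q₁ ≃ₗ[R] L)
        (Q₂ : Type t) [CommRing Q₂] [Algebra R Q₂] (e₂ : QuinticResolvent.ModBase R Q₂ ≃ₗ[R] L),
        QuinticResolvent.IsQuinticRing R Q₁ → QuinticResolvent.IsResolvent e₁ φ θ →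
        QuinticResolvent.IsQuinticRing R Q₂ → QuinticResolvent.IsResolvent e₂ φ θ →
        ∃ f : Q₁ ≃ₐ[R] Q₂, ∀ q : Q₁,
          e₂ (Submodule.Quotient.mk (f q)) = e₁ (Submodule.Quotient.mk q)) := by
  refine ⟨?_, fun Q₁ _ _ e₁ Q₂ _ _ e₂ hQ₁ hres₁ hQ₂ hres₂ =>
    QuinticResolvent.exists_algEquiv hL hQ₁ hres₁ hQ₂ hres₂⟩
  obtain ⟨P, hP⟩ := QuinticResolvent.exists_isResolvent hL hM φ θ
  exact ⟨P.Ring, inferInstance, inferInstance, P.modBaseEquiv, P.isQuinticRing hL, hP⟩
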